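/- Let $(\Omega,d)$ be a metric space and $\mu$ a Borel measure on it with $0<\mu(B)<\infty$ for every ball $B$, $\mu(\Omega)=\infty$ and $\mu(\{x\})=0$ for all $x\in\Omega$. Let $\alpha,b,s>0$, $c\ge 1$ and $1\le p\le\infty$ (with $1/\infty=0$). Assume that $\mu$ is $\alpha$-lower bounded, $\mu(B(x,r))\ge b\,r^{\alpha}$ for all $x\in\Omega$, $r>0$, and $c$-almost continuous: for all $t>0$ and $x\in\Omega$ there is $r>0$ with $t\le\mu(B(x,r))\le ct$. For $f:\Omega\to\mathbb R$ let $D^s(f)$ be the set of all nonnegative measurable $g$ with $|f(x)-f(y)|\le d(x,y)^s(g(x)+g(y))$ for all $x,y$ outside some $\mu$-null set. Let $M^{s,p}(\Omega)$ be the set of $f\in L^p(\Omega)$ for which $D^s(f)\cap L^p(\Omega)\neq\emptyset$, with $\|f\|_{M^{s,p}}=\|f\|_{L^p}+\inf_{g\in D^s(f)}\|g\|_{L^p}$. Put $$f^*(t)=\inf\{a\ge 0:\mu\{|f|>a\}\le t\},\qquad f^{**}(t)=\frac1t\int_0^t f^*(z)\,dz,$$ $$\|f\|_{L^{q,p}}=\Big(\int_0^\infty\big(t^{1/q}f^{**}(t)\big)^p\frac{dt}{t}\Big)^{1/p},\qquad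 \|f\|_{L^1+L^\infty}=\inf_{f=f_0+f_1}\big(\|f_0\|_{L^1}+\|f_1\|_{L^\infty}\big),$$ and $\|f\|_{L^\infty_w}=\sup_{t>0}(f^{**}(t)-f^*(t))$. Then there is a constant $C>0$ depending only on $p,s,\alpha,b,c$ such that for every $f\in M^{s,p}(\Omega)$ and every $g\in D^s(f)$ the following hold. 1. Suppose $s/\alpha<1$. (a) If $s/\alpha<1/p$, then $\|f\|_{L^{p^*,p}}\le C\|g\|_{L^p}$, where $p^*=\frac{\alpha p}{\alpha-sp}$. (b) If $s/\alpha=1/p$, then $$\Big(\int_0^1\Big(\frac{f^{**}(t)}{1+\ln(1/t)}\Big)^p\frac{dt}{t}\Big)^{1/p}\le C\big(\|g\|_{L^p}+\|f\|_{L^1+L^\infty}\big).$$ (c) If $s/\alpha>1/p$, then $\|f\|_{L^\infty}\le C\big(\|g\|_{L^p}+\|f\|_{L^1+L^\infty}\big)$. 2. If $s/\alpha=1$, then $$\sup_{t>0}t^{1/p}\,\frac{f^{**}(t)-f^*(t)}{t}\le C\|g\|_{L^p};$$ in particular, if moreover $p=1$, then $\|f\|_{L^\infty_w}\le C\|f\|_{M^{s,1}}$.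 3. If $s/\alpha>1$, then $\|f\|_{L^\infty}\le C\big(\|g\|_{L^p}+\|f\|_{L^1+L^\infty}\big)$. -/

import Mathlib

open MeasureTheory Set
open scoped ENNReal NNReal

noncomputable section

namespace HajlaszSobolev

variable {Ω : Type*}

/-- Standing assumptions on a metric measure space: balls have positive finite measure,
the whole space has infinite measure, and points have measure zero. -/
structure IsMetricMeasure [MetricSpace Ω] [MeasurableSpace Ω] (μ : Measure Ω) : Prop where
  ball_pos : ∀ (x : Ω) (r : ℝ), 0 < r → 0 < μ (Metric.ball x r)
  ball_lt_top : ∀ (x : Ω) (r : ℝ), 0 < r → μ (Metric.ball x r) < ∞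
  univ_eq_top : μ univ = ∞
  singleton_eq_zero : ∀ x : Ω, μ {x} = 0

/-- `μ` is `α`-lower bounded with constant `b`: `μ (B(x, r)) ≥ b r ^ α` for all balls. -/
def IsLowerBounded [MetricSpace Ω] [MeasurableSpace Ω] (α b : ℝ) (μ : Measure Ω) : Prop :=
  ∀ (x : Ω) (r : ℝ), 0 < r → ENNReal.ofReal (b * r ^ α) ≤ μ (Metric.ball x r)

/-- `μ` is `c`-almost continuous: for every `t > 0`, every point is the center of a ball
whose measure lies between `t` and `c t`. -/
def IsAlmostContinuous [MetricSpace Ω] [MeasurableSpace Ω] (c : ℝ) (μ : Measure Ω) : Prop :=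
  ∀ t : ℝ, 0 < t → ∀ x : Ω, ∃ r : ℝ, 0 < r ∧
    ENNReal.ofReal t ≤ μ (Metric.ball x r) ∧ μ (Metric.ball x r) ≤ ENNReal.ofReal (c * t)

/-- The collection `D^s(f)` of all `s`-gradients of `f`: nonnegative measurable `g` with
`|f x - f y| ≤ d(x, y) ^ s (g x + g y)` for all `x, y` outside a null set. -/
def gradients [MetricSpace Ω] [MeasurableSpace Ω] (s : ℝ) (f : Ω → ℝ) (μ : Measure Ω) :
    Set (Ω → ℝ) :=
  {g | AEStronglyMeasurable g μ ∧ (∀ᵐ x ∂μ, 0 ≤ g x) ∧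
    ∃ N : Set Ω, μ N = 0 ∧ ∀ x ∉ N, ∀ y ∉ N, |f x - f y| ≤ dist x y ^ s * (g x + g y)}

/-- `f ∈ M^{s,p}`: `f ∈ L^p` and `f` has an `s`-gradient in `L^p`. -/
def MemHajlaszSobolev [MetricSpace Ω] [MeasurableSpace Ω] (s : ℝ) (p : ℝ≥0∞) (f : Ω → ℝ)
    (μ : Measure Ω) : Prop :=
  MemLp f p μ ∧ ∃ g ∈ gradients s f μ, MemLp g p μ

/-- The norm of `M^{s,p}`: `‖f‖_p + inf {‖g‖_p : g ∈ D^s(f)}`. -/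
def hajlaszSobolevNorm [MetricSpace Ω] [MeasurableSpace Ω] (s : ℝ) (p : ℝ≥0∞) (f : Ω → ℝ)
    (μ : Measure Ω) : ℝ≥0∞ :=
  eLpNorm f p μ + ⨅ g ∈ gradients s f μ, eLpNorm g p μ

/-- The decreasing rearrangement `f*(t) = inf {a ≥ 0 : μ {|f| > a} ≤ t}`, for `t ≥ 0`. -/
def rearrangement [MeasurableSpace Ω] (f : Ω → ℝ) (μ : Measure Ω) (t : ℝ) : ℝ≥0∞ :=
  sInf {a : ℝ≥0∞ | μ {x | a < ‖f x‖ₑ} ≤ ENNReal.ofReal t}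

/-- `f**(t) = (1 / t) ∫₀ᵗ f*(z) dz`, for `t > 0`. -/
def maximalRearrangement [MeasurableSpace Ω] (f : Ω → ℝ) (μ : Measure Ω) (t : ℝ) : ℝ≥0∞ :=
  (∫⁻ z in Ioo 0 t, rearrangement f μ z) / ENNReal.ofReal t

/-- The oscillation `f**(t) - f*(t)`, for `t > 0`. As `f* ≤ f**`, and `f**` is finite when
`f ∈ L¹ + L^∞`, the truncated subtraction of `ℝ≥0∞` is the usual one. -/
def oscillation [MeasurableSpace Ω] (f : Ω → ℝ) (μ : Measure Ω) (t : ℝ) : ℝ≥0∞ :=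
  maximalRearrangement f μ t - rearrangement f μ t

/-- The Lorentz norm `‖f‖_{L^{q,p}} = (∫₀^∞ (t^{1/q} f**(t))^p dt / t)^{1/p}`, for finite
exponents `q, p`. -/
def lorentzNorm [MeasurableSpace Ω] (q p : ℝ) (f : Ω → ℝ) (μ : Measure Ω) : ℝ≥0∞ :=
  (∫⁻ t in Ioi (0 : ℝ), (ENNReal.ofReal (t ^ (1 / q)) * maximalRearrangement f μ t) ^ p /
    ENNReal.ofReal t) ^ (1 / p)

/-- The logarithmic functional `(∫₀¹ (f**(t) / (1 + ln (1/t)))^p dt / t)^{1/p}`. -/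
def logNorm [MeasurableSpace Ω] (p : ℝ) (f : Ω → ℝ) (μ : Measure Ω) : ℝ≥0∞ :=
  (∫⁻ t in Ioo (0 : ℝ) 1,
    (maximalRearrangement f μ t / ENNReal.ofReal (1 + Real.log (1 / t))) ^ p /
      ENNReal.ofReal t) ^ (1 / p)

/-- The norm of `L¹ + L^∞`: the infimum of `‖f₀‖₁ + ‖f₁‖_∞` over decompositions
`f = f₀ + f₁`. -/
def sumNorm [MeasurableSpace Ω] (f : Ω → ℝ) (μ : Measure Ω) : ℝ≥0∞ :=
  ⨅ (f₀ : Ω → ℝ) (f₁ : Ω → ℝ) (_ : AEStronglyMeasurable f₀ μ) (_ : AEStronglyMeasurable f₁ μ)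
    (_ : f =ᵐ[μ] f₀ + f₁), eLpNorm f₀ 1 μ + eLpNorm f₁ ∞ μ

/-- The weak-`L^∞` functional `sup_{t > 0} (f**(t) - f*(t))`. -/
def weakLinftyNorm [MeasurableSpace Ω] (f : Ω → ℝ) (μ : Measure Ω) : ℝ≥0∞ :=
  ⨆ (t : ℝ) (_ : 0 < t), oscillation f μ t

end HajlaszSobolev

end

/-!
Write `σ = s / α`. The whole theorem rests on one pointwise estimate,
`ae_enorm_le_rearrangement_add`: for every `t > 0` and almost every `x`,
`|f x| ≤ f*(t) + K t ^ σ (|g x| + g*(t))`.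
By almost continuity `x` is the centre of a ball of measure comparable to `3 t`, whose radius is
`O(t ^ (1 / α))` by the lower bound, and this ball is too large to be covered by the sets
`{|f| > f*(t)}` and `{|g| > g*(t)}`, so that `x` can be compared with a good point of the ball.

Rearranging this estimate gives `f*(t) ≤ f*(2 t) + C t ^ σ g*(t)`
(`rearrangement_le_rearrangement_two_mul_add`); integrating it over `{|f| > f*(t)}` gives
`f**(t) - f*(t) ≤ C t ^ σ g**(t)` (`oscillation_le_maximalRearrangement`) and
`f**(t / 2) ≤ f**(t) + C t ^ σ g**(t)` (`maximalRearrangement_half_le`). Then: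

* for `σ < 1 / p`, iterating the first inequality up to infinity bounds `f*(t)` by the series of
  `C (2 ^ k t) ^ σ g*(2 ^ k t)`. In `L^p(dt / t)` with weight `t ^ (1 / p - σ)`, dilation by `2 ^ k`
  gains a geometric factor, so Minkowski's inequality bounds `f*`, and then its average `f**`, by
  the `L^p` norm of `g*`, which is that of `g`. Working with `g*` instead of `g**` is what makes the
  argument valid for `p = 1`;
* for `σ = 1 / p`, the numbers `f**(2 ^ (-n))` have increments controlled by the sequence
  `2 ^ (-n σ) g**(2 ^ (-n))`, whose `ℓ^p` norm is at most a multiple of that of `g`, and the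
  discrete Hardy inequality applies with weight `1 / (n + 1) ~ 1 / (1 + ln (1 / t))`;
* for `σ > 1 / p`, the first inequality is iterated from `t = 1` down to `0`, where
  `g*(t) ≤ t ^ (-1 / p) ‖g‖_p` makes the series geometric;
* for `σ = 1`, the oscillation bound is combined with `g**(t) ≤ t ^ (-1 / p) ‖g‖_p`.
-/

namespace HajlaszSobolev

/-! ### Distribution functions and the decreasing rearrangement -/

/-- Layer-cake formula for a truncated function: only the levels below `n` contribute. -/
theorem lintegral_min_natCast_eq {X : Type*} [MeasurableSpace X] {μ : Measure X}
    {u : X → ℝ≥0∞} (hu : AEMeasurable u μ) (n : ℕ) :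
    ∫⁻ x, min (u x) n ∂μ =
      ∫⁻ a in Ioi (0 : ℝ), if a < n then μ {x | ENNReal.ofReal a < u x} else 0 := by
  have h1 : ∀ x, min (u x) n ≠ ∞ := fun x =>
    (lt_of_le_of_lt (min_le_right _ _) (ENNReal.natCast_lt_top n)).ne
  have h2 := lintegral_eq_lintegral_meas_lt (f := fun x => (min (u x) n).toReal) μ
    (Filter.Eventually.of_forall fun x => ENNReal.toReal_nonneg)
    (hu.min aemeasurable_const).ennreal_toReal
  simp only [ENNReal.ofReal_toReal (h1 _)] at h2
  rw [h2]
  refine setLIntegral_congr_fun measurableSet_Ioi fun a ha => ?_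
  have ha0 : 0 ≤ a := le_of_lt ha
  have h3 : ∀ x, a < (min (u x) n).toReal ↔ ENNReal.ofReal a < u x ∧ a < n := by
    intro x
    rw [← ENNReal.ofReal_lt_iff_lt_toReal ha0 (h1 x), lt_min_iff, ← ENNReal.ofReal_natCast n,
      ENNReal.ofReal_lt_ofReal_iff_of_nonneg ha0]
  by_cases han : a < n <;> simp [h3, han]

theorem lintegral_eq_iSup_min {X : Type*} [MeasurableSpace X] {μ : Measure X}
    {u : X → ℝ≥0∞} (hu : AEMeasurable u μ) :
    ∫⁻ x, u x ∂μ = ⨆ n : ℕ, ∫⁻ x, min (u x) n ∂μ := by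
  rw [← lintegral_iSup' (fun n => hu.min aemeasurable_const)
    (Filter.Eventually.of_forall fun x m n hmn => min_le_min le_rfl (by exact_mod_cast hmn))]
  refine lintegral_congr fun x => ?_
  change u x = ⨆ n : ℕ, u x ⊓ n
  rw [← inf_iSup_eq, ENNReal.iSup_natCast, inf_top_eq]

/-- A function with a smaller distribution function has a smaller integral, by the layer-cake
formula. The truncations at height `n` reduce it to real-valued functions. -/
theorem lintegral_le_of_meas_lt_le {X Y : Type*} [MeasurableSpace X] [MeasurableSpace Y]
    {μ : Measure X} {ν : Measure Y} {u : X → ℝ≥0∞} {v : Y → ℝ≥0∞}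
    (hu : AEMeasurable u μ) (hv : AEMeasurable v ν)
    (h : ∀ a : ℝ≥0∞, ν {y | a < v y} ≤ μ {x | a < u x}) :
    ∫⁻ y, v y ∂ν ≤ ∫⁻ x, u x ∂μ := by
  rw [lintegral_eq_iSup_min hv]
  refine iSup_le fun n => ?_
  calc ∫⁻ y, min (v y) n ∂ν ≤ ∫⁻ x, min (u x) n ∂μ := by
        rw [lintegral_min_natCast_eq hv, lintegral_min_natCast_eq hu]
        refine lintegral_mono fun a => ?_
        split_ifs
        · exact h _
        · exact le_rfl
    _ ≤ ∫⁻ x, u x ∂μ := lintegral_mono fun x => min_le_left _ _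

theorem lintegral_Ioi_comp_mul_left {l : ℝ} (hl : 0 < l) (F : ℝ → ℝ≥0∞) :
    ∫⁻ t in Ioi (0 : ℝ), F (l * t) = ENNReal.ofReal l⁻¹ * ∫⁻ t in Ioi (0 : ℝ), F t := by
  have h := (measurableEmbedding_mulLeft₀ hl.ne').lintegral_map (μ := volume)
    ((Ioi (0 : ℝ)).indicator F)
  rw [Real.map_volume_mul_left hl.ne', lintegral_smul_measure,
    abs_of_pos (inv_pos.2 hl), lintegral_indicator measurableSet_Ioi] at h
  rw [← smul_eq_mul, h, ← lintegral_indicator measurableSet_Ioi]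
  refine lintegral_congr fun t => ?_
  by_cases ht : 0 < t
  · rw [indicator_of_mem (mem_Ioi.2 ht), indicator_of_mem (mem_Ioi.2 (mul_pos hl ht))]
  · rw [indicator_of_notMem (by simpa using ht),
      indicator_of_notMem (by simpa [mul_pos_iff_of_pos_left hl] using ht)]

section Rearrangement

variable {X : Type*} [MeasurableSpace X] {μ : Measure X} {f : X → ℝ}

/-- The infimum defining `f*` is attained, so `f*` and the distribution function of `f` are
generalized inverses of each other. -/
theorem lt_rearrangement_iff {a : ℝ≥0∞} {t : ℝ} :
    a < rearrangement f μ t ↔ ENNReal.ofReal t < μ {x | a < ‖f x‖ₑ} := by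
  set S : Set ℝ≥0∞ := {a | μ {x | a < ‖f x‖ₑ} ≤ ENNReal.ofReal t} with hS
  have hr : rearrangement f μ t = sInf S := rfl
  constructor
  · intro h
    by_contra hcon
    exact absurd (sInf_le (show a ∈ S from not_lt.1 hcon)) (not_le.2 (hr ▸ h))
  · intro h
    by_contra hcon
    have hSne : S.Nonempty := ⟨∞, by simp [hS]⟩
    obtain ⟨v, hv, hlim, hvS⟩ := exists_seq_tendsto_sInf hSne (OrderBot.bddBelow S)
    have hunion : {x | sInf S < ‖f x‖ₑ} = ⋃ n, {x | v n < ‖f x‖ₑ} := by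
      ext x
      simp only [mem_ofPred_eq, mem_iUnion]
      refine ⟨fun hx => ((hlim.eventually_lt_const hx).exists), fun ⟨n, hn⟩ => ?_⟩
      exact (sInf_le (hvS n)).trans_lt hn
    have hmono : Monotone fun n => {x | v n < ‖f x‖ₑ} := fun m n hmn x hx =>
      (hv hmn).trans_lt hx
    have hle : μ {x | sInf S < ‖f x‖ₑ} ≤ ENNReal.ofReal t := by
      rw [hunion, hmono.measure_iUnion]
      exact iSup_le hvS
    refine absurd h (not_lt.2 (le_trans (measure_mono fun x hx => ?_) hle))
    exact lt_of_le_of_lt (hr ▸ not_lt.1 hcon) hx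

theorem measure_rearrangement_lt_le (t : ℝ) :
    μ {x | rearrangement f μ t < ‖f x‖ₑ} ≤ ENNReal.ofReal t :=
  not_lt.1 fun h => lt_irrefl _ (lt_rearrangement_iff.2 h)

theorem rearrangement_antitone : Antitone (rearrangement f μ) := by
  intro s t hst
  refine sInf_le_sInf fun a ha => ?_
  exact le_trans ha (ENNReal.ofReal_le_ofReal hst)

theorem measurable_rearrangement : Measurable (rearrangement f μ) :=
  rearrangement_antitone.measurable

theorem setOf_lt_rearrangement (a : ℝ≥0∞) :
    {z | a < rearrangement f μ z} ∩ Ioi 0 =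
      {z | ENNReal.ofReal z < μ {x | a < ‖f x‖ₑ}} ∩ Ioi 0 := by
  simp only [lt_rearrangement_iff]

theorem volume_ofReal_lt (m : ℝ≥0∞) :
    volume ({z : ℝ | ENNReal.ofReal z < m} ∩ Ioi 0) = m := by
  rcases eq_or_ne m ∞ with rfl | hm
  · simp
  · have : {z : ℝ | ENNReal.ofReal z < m} ∩ Ioi 0 = Ioo 0 m.toReal := by
      ext z
      simp only [mem_inter_iff, mem_ofPred_eq, mem_Ioi, mem_Ioo]
      constructor
      · rintro ⟨h, hz⟩
        exact ⟨hz, (ENNReal.ofReal_lt_iff_lt_toReal hz.le hm).1 h⟩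
      · rintro ⟨hz, h⟩
        exact ⟨(ENNReal.ofReal_lt_iff_lt_toReal hz.le hm).2 h, hz⟩
    rw [this, Real.volume_Ioo, sub_zero, ENNReal.ofReal_toReal hm]

/-- `f` and `f*` are equimeasurable. -/
theorem volume_lt_rearrangement (a : ℝ≥0∞) :
    volume.restrict (Ioi 0) {z | a < rearrangement f μ z} = μ {x | a < ‖f x‖ₑ} := by
  rw [Measure.restrict_apply (measurableSet_lt measurable_const measurable_rearrangement),
    setOf_lt_rearrangement, volume_ofReal_lt]

theorem volume_Ioo_lt_rearrangement (a : ℝ≥0∞) (t : ℝ) :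
    volume.restrict (Ioo 0 t) {z | a < rearrangement f μ z} =
      min (ENNReal.ofReal t) (μ {x | a < ‖f x‖ₑ}) := by
  rw [Measure.restrict_apply (measurableSet_lt measurable_const measurable_rearrangement)]
  have : {z | a < rearrangement f μ z} ∩ Ioo 0 t =
      {z : ℝ | ENNReal.ofReal z < min (ENNReal.ofReal t) (μ {x | a < ‖f x‖ₑ})} ∩ Ioi 0 := by
    ext z
    simp only [mem_inter_iff, mem_ofPred_eq, mem_Ioo, mem_Ioi, lt_min_iff,
      lt_rearrangement_iff]
    constructor
    · rintro ⟨h, hz, hzt⟩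
      exact ⟨⟨(ENNReal.ofReal_lt_ofReal_iff_of_nonneg hz.le).2 hzt, h⟩, hz⟩
    · rintro ⟨⟨h1, h⟩, hz⟩
      exact ⟨h, hz, (ENNReal.ofReal_lt_ofReal_iff_of_nonneg hz.le).1 h1⟩
  rw [this, volume_ofReal_lt]

/-- Hardy–Littlewood: the integral over a set of measure at most `t` is bounded by that of `f*`
over `(0, t)`. -/
theorem setLIntegral_enorm_le_rearrangement (hf : AEStronglyMeasurable f μ) {E : Set X} {t : ℝ}
    (hE : μ E ≤ ENNReal.ofReal t) :
    ∫⁻ x in E, ‖f x‖ₑ ∂μ ≤ ∫⁻ z in Ioo 0 t, rearrangement f μ z := by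
  refine lintegral_le_of_meas_lt_le measurable_rearrangement.aemeasurable hf.enorm.restrict
    fun a => ?_
  rw [volume_Ioo_lt_rearrangement]
  refine le_min ?_ (Measure.restrict_apply_le _ _)
  exact (measure_mono (subset_univ _)).trans (by simpa using hE)

/-- By equimeasurability, truncating `f*` from below at a level costs no more than truncating `|f|`
at the same level. -/
theorem lintegral_rearrangement_sub_le (hf : AEStronglyMeasurable f μ) (t : ℝ) (l : ℝ≥0∞) :
    ∫⁻ z in Ioo 0 t, (rearrangement f μ z - l) ≤ ∫⁻ x, (‖f x‖ₑ - l) ∂μ := by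
  refine lintegral_le_of_meas_lt_le (hf.enorm.sub_const l)
    (measurable_rearrangement.sub_const l).aemeasurable fun a => ?_
  simp only [lt_tsub_iff_right]
  rw [volume_Ioo_lt_rearrangement]
  exact min_le_right _ _

theorem eLpNorm_rearrangement_le (hf : AEStronglyMeasurable f μ) {p : ℝ≥0∞} (hp : p ≠ 0) :
    eLpNorm (rearrangement f μ) p (volume.restrict (Ioi 0)) ≤ eLpNorm f p μ := by
  rcases eq_or_ne p ∞ with rfl | hp'
  · rw [eLpNorm_exponent_top, eLpNorm_exponent_top]
    refine eLpNormEssSup_le_of_ae_enorm_bound ?_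
    refine Filter.Eventually.of_forall fun z => ?_
    rw [enorm_eq_self]
    refine sInf_le ?_
    have : μ {x | eLpNormEssSup f μ < ‖f x‖ₑ} = 0 := meas_eLpNormEssSup_lt
    simp [this]
  · rw [eLpNorm_eq_lintegral_rpow_enorm_toReal hp hp', eLpNorm_eq_lintegral_rpow_enorm_toReal hp hp']
    have hp0 : 0 < p.toReal := ENNReal.toReal_pos hp hp'
    refine ENNReal.rpow_le_rpow ?_ (by positivity)
    refine lintegral_le_of_meas_lt_le (hf.enorm.pow_const _)
      (measurable_rearrangement.pow_const _).aemeasurable fun a => ?_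
    simp only [enorm_eq_self, ← ENNReal.rpow_inv_lt_iff hp0]
    rw [volume_lt_rearrangement]

theorem lintegral_rearrangement_eq_mul {t : ℝ} (ht : 0 < t) :
    ∫⁻ z in Ioo 0 t, rearrangement f μ z = ENNReal.ofReal t * maximalRearrangement f μ t := by
  rw [maximalRearrangement, ENNReal.mul_div_cancel (by simpa using ht) ENNReal.ofReal_ne_top]

/-- Rescaled to a fixed interval, `f**` is an average of dilates of `f*`; its monotonicity and the
comparison with `f*` follow from this form. -/
theorem maximalRearrangement_eq_lintegral {t : ℝ} (ht : 0 < t) :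
    maximalRearrangement f μ t = ∫⁻ u in Ioo (0 : ℝ) 1, rearrangement f μ (t * u) := by
  have h := lintegral_Ioi_comp_mul_left ht ((Iio t).indicator (rearrangement f μ))
  rw [setLIntegral_indicator measurableSet_Iio] at h
  have h2 : ∀ u, (Iio t).indicator (rearrangement f μ) (t * u) =
      (Iio 1).indicator (fun u => rearrangement f μ (t * u)) u := by
    intro u
    by_cases hu : u < 1
    · rw [indicator_of_mem (mem_Iio.2 hu),
        indicator_of_mem (mem_Iio.2 (by nlinarith))]
    · rw [indicator_of_notMem (by simp only [mem_Iio, not_lt] at hu ⊢; nlinarith),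
        indicator_of_notMem (by simpa using hu)]
  simp only [h2] at h
  rw [setLIntegral_indicator measurableSet_Iio, inter_comm, inter_comm (Iio t), Ioi_inter_Iio,
    Ioi_inter_Iio] at h
  rw [h, maximalRearrangement, ENNReal.div_eq_inv_mul, ENNReal.ofReal_inv_of_pos ht]

theorem maximalRearrangement_antitoneOn : AntitoneOn (maximalRearrangement f μ) (Ioi 0) := by
  intro s hs t ht hst
  rw [maximalRearrangement_eq_lintegral hs, maximalRearrangement_eq_lintegral ht]
  refine setLIntegral_mono' measurableSet_Ioo fun u hu => rearrangement_antitone ?_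
  exact mul_le_mul_of_nonneg_right hst hu.1.le

theorem rearrangement_le_maximalRearrangement {t : ℝ} (ht : 0 < t) :
    rearrangement f μ t ≤ maximalRearrangement f μ t := by
  rw [maximalRearrangement_eq_lintegral ht]
  calc rearrangement f μ t = ∫⁻ _ in Ioo (0 : ℝ) 1, rearrangement f μ t := by simp
    _ ≤ _ := setLIntegral_mono' measurableSet_Ioo fun u hu =>
      rearrangement_antitone (by nlinarith [hu.2])

theorem maximalRearrangement_le_eLpNorm (hf : AEStronglyMeasurable f μ) {p : ℝ≥0∞} (hp : 1 ≤ p)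
    {t : ℝ} (ht : 0 < t) :
    maximalRearrangement f μ t ≤ ENNReal.ofReal (t ^ (-(1 / p).toReal)) * eLpNorm f p μ := by
  have h1 : ∫⁻ z in Ioo 0 t, rearrangement f μ z ≤
      eLpNorm f p μ * ENNReal.ofReal t ^ (1 - (1 / p).toReal) := by
    have h := eLpNorm_le_eLpNorm_mul_rpow_measure_univ (μ := volume.restrict (Ioo 0 t))
      (f := rearrangement f μ) hp measurable_rearrangement.aestronglyMeasurable
    rw [eLpNorm_one_eq_lintegral_enorm, Measure.restrict_apply_univ, Real.volume_Ioo,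
      sub_zero] at h
    simp only [enorm_eq_self, ENNReal.toReal_one, div_one] at h
    rw [ENNReal.toReal_div, ENNReal.toReal_one]
    refine h.trans (mul_le_mul_left ?_ _)
    refine le_trans ?_ (eLpNorm_rearrangement_le hf (zero_lt_one.trans_le hp).ne')
    exact eLpNorm_mono_measure _ (Measure.restrict_mono Ioo_subset_Ioi_self le_rfl)
  rw [maximalRearrangement]
  refine ENNReal.div_le_of_le_mul (h1.trans (le_of_eq ?_))
  rw [ENNReal.ofReal_rpow_of_pos ht, mul_comm (ENNReal.ofReal _), mul_assoc,
    ← ENNReal.ofReal_mul (by positivity)]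
  congr 2
  rw [← Real.rpow_add_one ht.ne']
  congr 1
  ring

theorem rearrangement_le_eLpNorm (hf : AEStronglyMeasurable f μ) {p : ℝ≥0∞} (hp : 1 ≤ p)
    {t : ℝ} (ht : 0 < t) :
    rearrangement f μ t ≤ ENNReal.ofReal (t ^ (-(1 / p).toReal)) * eLpNorm f p μ :=
  (rearrangement_le_maximalRearrangement ht).trans (maximalRearrangement_le_eLpNorm hf hp ht)

/-- With `M = ‖f₁‖_∞`, the part of `|f|` above the level `M` is bounded by `|f₀|`. -/
theorem maximalRearrangement_one_le_sumNorm (hf : AEStronglyMeasurable f μ) :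
    maximalRearrangement f μ 1 ≤ sumNorm f μ := by
  refine le_iInf fun f₀ => le_iInf fun f₁ => le_iInf fun _ => le_iInf fun _ => le_iInf fun h => ?_
  rw [maximalRearrangement, ENNReal.ofReal_one, div_one, add_comm, eLpNorm_one_eq_lintegral_enorm]
  set M := eLpNorm f₁ ∞ μ with hM
  calc ∫⁻ z in Ioo 0 1, rearrangement f μ z
      ≤ ∫⁻ z in Ioo (0 : ℝ) 1, (M + (rearrangement f μ z - M)) :=
        lintegral_mono fun z => le_add_tsub
    _ = M + ∫⁻ z in Ioo (0 : ℝ) 1, (rearrangement f μ z - M) := by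
        rw [lintegral_add_left measurable_const]; simp
    _ ≤ M + ∫⁻ x, (‖f x‖ₑ - M) ∂μ := by
        gcongr; exact lintegral_rearrangement_sub_le hf 1 M
    _ ≤ M + ∫⁻ x, ‖f₀ x‖ₑ ∂μ := by
        gcongr 1
        refine lintegral_mono_ae ?_
        filter_upwards [h, enorm_ae_le_eLpNormEssSup f₁ μ] with x hx hx1
        rw [hx, tsub_le_iff_right, Pi.add_apply]
        refine (enorm_add_le _ _).trans ?_
        gcongr
        rwa [hM, eLpNorm_exponent_top]

/-- `|f|` is essentially bounded by any common bound of the values of `f*` along a sequence of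
positive arguments tending to zero. -/
theorem eLpNorm_top_le_of_rearrangement_le {A : ℝ≥0∞}
    (h : ∀ n : ℕ, rearrangement f μ ((2 : ℝ)⁻¹ ^ n) ≤ A) : eLpNorm f ∞ μ ≤ A := by
  rw [eLpNorm_exponent_top]
  refine eLpNormEssSup_le_of_ae_enorm_bound ?_
  rw [ae_iff]
  simp only [not_le]
  by_contra hne
  have hlim : Filter.Tendsto (fun n : ℕ => ENNReal.ofReal ((2 : ℝ)⁻¹ ^ n)) Filter.atTop
      (nhds 0) := by
    rw [← ENNReal.ofReal_zero]
    exact ENNReal.tendsto_ofReal (tendsto_pow_atTop_nhds_zero_of_lt_one (by norm_num) (by norm_num))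
  obtain ⟨n, hn⟩ := (hlim.eventually_lt_const (pos_iff_ne_zero.2 hne)).exists
  exact absurd (h n) (not_le.2 (lt_rearrangement_iff.2 hn))

end Rearrangement

/-! ### Pointwise and oscillation estimates for gradients -/

section Gradient

variable {Ω : Type*} [MetricSpace Ω] [MeasurableSpace Ω] {μ : Measure Ω} {f g : Ω → ℝ}
  {s α b c : ℝ}

/-- The pointwise estimate behind every embedding. Almost every `x` is the centre of a ball whose
measure lies in `[3t, 3ct]`, hence whose radius is `O(t ^ (1 / α))`. The sets
`{|f| > f*(t)}` and `{|g| > g*(t)}` have measure at most `t`, so they cannot cover that ball, and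
the gradient inequality can be used with a point `y` of the ball outside both. -/
theorem ae_enorm_le_rearrangement_add (hs : 0 < s) (hα : 0 < α) (hb : 0 < b) (hc : 1 ≤ c)
    (hac : IsAlmostContinuous c μ) (hlb : IsLowerBounded α b μ) (hg : g ∈ gradients s f μ)
    {t : ℝ} (ht : 0 < t) :
    ∀ᵐ x ∂μ, ‖f x‖ₑ ≤ rearrangement f μ t +
      ENNReal.ofReal ((3 * c / b) ^ (s / α) * t ^ (s / α)) * (‖g x‖ₑ + rearrangement g μ t) := by
  obtain ⟨-, hg0, N, hN, hgrad⟩ := hg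
  have hN' : ∀ᵐ x ∂μ, x ∉ N := by rw [ae_iff]; simpa using hN
  filter_upwards [hg0, hN'] with x hx0 hxN
  obtain ⟨r, hr, hr1, hr2⟩ := hac (3 * t) (by positivity) x
  -- The lower bound turns the upper bound `3ct` for the measure of the ball into one for `r`.
  have hrs : r ^ s ≤ (3 * c / b) ^ (s / α) * t ^ (s / α) := by
    have h1 : b * r ^ α ≤ c * (3 * t) :=
      (ENNReal.ofReal_le_ofReal_iff (by positivity)).1 ((hlb x r hr).trans hr2)
    have h2 : r ^ α ≤ 3 * c / b * t := by
      rw [div_mul_eq_mul_div, le_div_iff₀ hb]; linarith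
    calc r ^ s = (r ^ α) ^ (s / α) := by
          rw [← Real.rpow_mul hr.le]; congr 1; field_simp
      _ ≤ (3 * c / b * t) ^ (s / α) := by gcongr
      _ = _ := Real.mul_rpow (by positivity) ht.le
  obtain ⟨y, hyB, hyf, hyg, hyN, hy0⟩ : ∃ y ∈ Metric.ball x r,
      ‖f y‖ₑ ≤ rearrangement f μ t ∧ ‖g y‖ₑ ≤ rearrangement g μ t ∧ y ∉ N ∧ 0 ≤ g y := by
    -- Otherwise a ball of measure at least `3t` is covered by two sets of measure at most `t`
    -- and a null set.
    by_contra hcon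
    push Not at hcon
    have hsub : Metric.ball x r ⊆ ({y | rearrangement f μ t < ‖f y‖ₑ} ∪
        {y | rearrangement g μ t < ‖g y‖ₑ}) ∪ (N ∪ {y | ¬ 0 ≤ g y}) := by
      intro y hy
      by_cases h1 : ‖f y‖ₑ ≤ rearrangement f μ t
      · by_cases h2 : ‖g y‖ₑ ≤ rearrangement g μ t
        · by_cases h3 : y ∈ N
          · exact Or.inr (Or.inl h3)
          · exact Or.inr (Or.inr (not_le.2 (hcon y hy h1 h2 h3)))
        · exact Or.inl (Or.inr (not_le.1 h2))
      · exact Or.inl (Or.inl (not_le.1 h1))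
    have hnull : μ (N ∪ {y | ¬ 0 ≤ g y}) = 0 := measure_union_null hN (ae_iff.1 hg0)
    have h4 : ENNReal.ofReal (3 * t) ≤ ENNReal.ofReal t + ENNReal.ofReal t :=
      calc ENNReal.ofReal (3 * t) ≤ μ (Metric.ball x r) := hr1
        _ ≤ _ := (measure_mono hsub).trans (measure_union_le _ _)
        _ ≤ ENNReal.ofReal t + ENNReal.ofReal t := by
          rw [hnull, add_zero]
          exact (measure_union_le _ _).trans
            (add_le_add (measure_rearrangement_lt_le t) (measure_rearrangement_lt_le t))
    rw [← ENNReal.ofReal_add ht.le ht.le, ENNReal.ofReal_le_ofReal_iff (by positivity)] at h4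
    linarith
  have hd : dist x y ^ s ≤ (3 * c / b) ^ (s / α) * t ^ (s / α) := by
    refine le_trans ?_ hrs
    rw [dist_comm]
    exact Real.rpow_le_rpow dist_nonneg (le_of_lt hyB) hs.le
  have hdiff : ‖f x - f y‖ₑ ≤
      ENNReal.ofReal ((3 * c / b) ^ (s / α) * t ^ (s / α)) * (‖g x‖ₑ + ‖g y‖ₑ) := by
    rw [Real.enorm_eq_ofReal hx0, Real.enorm_eq_ofReal hy0, ← ENNReal.ofReal_add hx0 hy0,
      ← ENNReal.ofReal_mul (by positivity), Real.enorm_eq_ofReal_abs]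
    refine ENNReal.ofReal_le_ofReal ((hgrad x hxN y hyN).trans ?_)
    gcongr
  calc ‖f x‖ₑ = ‖f y + (f x - f y)‖ₑ := by congr 1; ring
    _ ≤ ‖f y‖ₑ + ‖f x - f y‖ₑ := enorm_add_le _ _
    _ ≤ _ := by gcongr; exact hdiff.trans (by gcongr)

/-- Off the set `{|g| > g*(t)}`, of measure at most `t`, the pointwise estimate at `2t` bounds `|f|`
by the right-hand side. -/
theorem rearrangement_le_rearrangement_two_mul_add (hs : 0 < s) (hα : 0 < α) (hb : 0 < b)
    (hc : 1 ≤ c) (hac : IsAlmostContinuous c μ) (hlb : IsLowerBounded α b μ)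
    (hg : g ∈ gradients s f μ) {t : ℝ} (ht : 0 < t) :
    rearrangement f μ t ≤ rearrangement f μ (2 * t) +
      ENNReal.ofReal (2 * (6 * c / b) ^ (s / α) * t ^ (s / α)) * rearrangement g μ t := by
  have h := ae_enorm_le_rearrangement_add hs hα hb hc hac hlb hg (t := 2 * t) (by positivity)
  have hconst : (3 * c / b) ^ (s / α) * (2 * t) ^ (s / α) =
      (6 * c / b) ^ (s / α) * t ^ (s / α) := by
    rw [← Real.mul_rpow (by positivity) (by positivity), ← Real.mul_rpow (by positivity) ht.le]
    congr 1; ring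
  rw [hconst] at h
  by_contra hcon
  rw [not_le, lt_rearrangement_iff] at hcon
  refine absurd hcon (not_lt.2 (le_trans (measure_mono_ae ?_)
    (measure_rearrangement_lt_le (f := g) t)))
  filter_upwards [h] with x hx hx1
  change rearrangement g μ t < ‖g x‖ₑ
  by_contra hgx
  rw [not_lt] at hgx
  refine absurd (hx1 : _ < ‖f x‖ₑ) (not_lt.2 (hx.trans ?_))
  have h2 : rearrangement g μ (2 * t) ≤ rearrangement g μ t :=
    rearrangement_antitone (by linarith)
  rw [mul_assoc 2, ENNReal.ofReal_mul (by norm_num : (0:ℝ) ≤ 2), ENNReal.ofReal_ofNat,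
    mul_assoc (2 : ℝ≥0∞), mul_left_comm (2 : ℝ≥0∞), two_mul (rearrangement g μ t)]
  gcongr

/-- The pointwise estimate, integrated over `{|f| > f*(t)}`, a set of measure at most `t`. -/
theorem lintegral_rearrangement_sub_self_le (hs : 0 < s) (hα : 0 < α) (hb : 0 < b) (hc : 1 ≤ c)
    (hac : IsAlmostContinuous c μ) (hlb : IsLowerBounded α b μ) (hf : AEStronglyMeasurable f μ)
    (hg : g ∈ gradients s f μ) {t : ℝ} (ht : 0 < t) :
    ∫⁻ z in Ioo 0 t, (rearrangement f μ z - rearrangement f μ t) ≤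
      ENNReal.ofReal t * (ENNReal.ofReal (2 * (3 * c / b) ^ (s / α) * t ^ (s / α)) *
        maximalRearrangement g μ t) := by
  set A := ENNReal.ofReal ((3 * c / b) ^ (s / α) * t ^ (s / α)) with hA
  set E := {x | rearrangement f μ t < ‖f x‖ₑ} with hE
  have hEm : NullMeasurableSet E μ := nullMeasurableSet_lt aemeasurable_const hf.enorm
  have hEt : μ E ≤ ENNReal.ofReal t := measure_rearrangement_lt_le t
  have h := ae_enorm_le_rearrangement_add hs hα hb hc hac hlb hg ht
  calc ∫⁻ z in Ioo 0 t, (rearrangement f μ z - rearrangement f μ t)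
      ≤ ∫⁻ x, (‖f x‖ₑ - rearrangement f μ t) ∂μ := lintegral_rearrangement_sub_le hf _ _
    _ = ∫⁻ x, E.indicator (fun x => ‖f x‖ₑ - rearrangement f μ t) x ∂μ := by
        refine lintegral_congr fun x => ?_
        by_cases hx : x ∈ E
        · rw [indicator_of_mem hx]
        · rw [indicator_of_notMem hx, tsub_eq_zero_of_le (not_lt.1 hx)]
    _ = ∫⁻ x in E, (‖f x‖ₑ - rearrangement f μ t) ∂μ := lintegral_indicator₀ hEm _
    _ ≤ ∫⁻ x in E, A * (‖g x‖ₑ + rearrangement g μ t) ∂μ := by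
        refine lintegral_mono_ae (ae_restrict_of_ae ?_)
        filter_upwards [h] with x hx
        rwa [tsub_le_iff_left]
    _ = A * (∫⁻ x in E, ‖g x‖ₑ ∂μ + rearrangement g μ t * μ E) := by
        rw [lintegral_const_mul' _ _ ENNReal.ofReal_ne_top, lintegral_add_right _ measurable_const,
          setLIntegral_const]
    _ ≤ A * (ENNReal.ofReal t * maximalRearrangement g μ t +
          maximalRearrangement g μ t * ENNReal.ofReal t) := by
        gcongr
        · rw [← lintegral_rearrangement_eq_mul ht]
          exact setLIntegral_enorm_le_rearrangement hg.1 hEt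
        · exact rearrangement_le_maximalRearrangement ht
    _ = _ := by
        rw [mul_assoc 2, ENNReal.ofReal_mul (by norm_num : (0:ℝ) ≤ 2), ENNReal.ofReal_ofNat,
          ← hA]
        ring

theorem oscillation_le_maximalRearrangement (hs : 0 < s) (hα : 0 < α) (hb : 0 < b) (hc : 1 ≤ c)
    (hac : IsAlmostContinuous c μ) (hlb : IsLowerBounded α b μ) (hf : AEStronglyMeasurable f μ)
    (hg : g ∈ gradients s f μ) {t : ℝ} (ht : 0 < t) :
    oscillation f μ t ≤
      ENNReal.ofReal (2 * (3 * c / b) ^ (s / α) * t ^ (s / α)) * maximalRearrangement g μ t := by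
  have ht' : ENNReal.ofReal t ≠ 0 := by simpa using ht
  rw [oscillation, tsub_le_iff_left, maximalRearrangement]
  refine ENNReal.div_le_of_le_mul ?_
  calc ∫⁻ z in Ioo 0 t, rearrangement f μ z
      ≤ ∫⁻ z in Ioo 0 t, (rearrangement f μ t + (rearrangement f μ z - rearrangement f μ t)) :=
        lintegral_mono fun z => le_add_tsub
    _ = rearrangement f μ t * ENNReal.ofReal t +
          ∫⁻ z in Ioo 0 t, (rearrangement f μ z - rearrangement f μ t) := by
        rw [lintegral_add_left measurable_const]; simp
    _ ≤ _ := by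
        rw [add_mul, mul_comm (ENNReal.ofReal (_ * _) * _)]
        gcongr
        exact lintegral_rearrangement_sub_self_le hs hα hb hc hac hlb hf hg ht

theorem maximalRearrangement_half_le (hs : 0 < s) (hα : 0 < α) (hb : 0 < b) (hc : 1 ≤ c)
    (hac : IsAlmostContinuous c μ) (hlb : IsLowerBounded α b μ) (hf : AEStronglyMeasurable f μ)
    (hg : g ∈ gradients s f μ) {t : ℝ} (ht : 0 < t) :
    maximalRearrangement f μ (2⁻¹ * t) ≤ maximalRearrangement f μ t +
      ENNReal.ofReal (4 * (3 * c / b) ^ (s / α) * t ^ (s / α)) * maximalRearrangement g μ t := by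
  have h2 : ENNReal.ofReal t = 2 * ENNReal.ofReal (2⁻¹ * t) := by
    rw [← ENNReal.ofReal_ofNat 2, ← ENNReal.ofReal_mul (by norm_num)]; congr 1; ring
  have h4 : ENNReal.ofReal (4 * (3 * c / b) ^ (s / α) * t ^ (s / α)) =
      2 * ENNReal.ofReal (2 * (3 * c / b) ^ (s / α) * t ^ (s / α)) := by
    rw [← ENNReal.ofReal_ofNat 2, ← ENNReal.ofReal_mul (by norm_num)]; congr 1; ring
  rw [maximalRearrangement]
  refine ENNReal.div_le_of_le_mul ?_
  calc ∫⁻ z in Ioo 0 (2⁻¹ * t), rearrangement f μ z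
      ≤ ∫⁻ z in Ioo 0 (2⁻¹ * t),
          (rearrangement f μ t + (rearrangement f μ z - rearrangement f μ t)) :=
        lintegral_mono fun z => le_add_tsub
    _ = rearrangement f μ t * ENNReal.ofReal (2⁻¹ * t) +
          ∫⁻ z in Ioo 0 (2⁻¹ * t), (rearrangement f μ z - rearrangement f μ t) := by
        rw [lintegral_add_left measurable_const]; simp
    _ ≤ maximalRearrangement f μ t * ENNReal.ofReal (2⁻¹ * t) +
          ∫⁻ z in Ioo 0 t, (rearrangement f μ z - rearrangement f μ t) := by
        gcongr
        · exact rearrangement_le_maximalRearrangement ht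
        · linarith
    _ ≤ _ := by
        rw [add_mul]
        gcongr 1
        refine (lintegral_rearrangement_sub_self_le hs hα hb hc hac hlb hf hg ht).trans
          (le_of_eq ?_)
        rw [h2, h4]
        ring

end Gradient

/-! ### Weighted `L^p` norms on the half-line -/

section PowerNorm

/-- **Minkowski's inequality** for countable sums of nonnegative functions. -/
theorem eLpNorm'_tsum_le {X : Type*} [MeasurableSpace X] {μ : Measure X} {h : ℕ → X → ℝ≥0∞}
    (hm : ∀ j, Measurable (h j)) {p : ℝ} (hp : 1 ≤ p) :
    eLpNorm' (fun x => ∑' j, h j x) p μ ≤ ∑' j, eLpNorm' (h j) p μ := by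
  have hp0 : 0 < p := by linarith
  have hpi : 0 < 1 / p := by positivity
  have h1 : ∀ x, (∑' j, h j x) ^ p = ⨆ n : ℕ, (∑ j ∈ Finset.range n, h j x) ^ p := by
    intro x
    rw [ENNReal.tsum_eq_iSup_nat]
    exact (ENNReal.orderIsoRpow p hp0).map_iSup _
  have h2 : eLpNorm' (fun x => ∑' j, h j x) p μ =
      ⨆ n : ℕ, eLpNorm' (∑ j ∈ Finset.range n, h j) p μ := by
    simp only [eLpNorm', enorm_eq_self, h1, Finset.sum_apply]
    rw [lintegral_iSup]
    · exact (ENNReal.orderIsoRpow (1 / p) hpi).map_iSup _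
    · intro n
      exact (Finset.measurable_fun_sum _ fun j _ => hm j).pow_const _
    · intro m n hmn x
      exact ENNReal.rpow_le_rpow
        (Finset.sum_le_sum_of_subset (Finset.range_mono hmn)) hp0.le
  rw [h2]
  exact iSup_le fun n => (eLpNorm'_sum_le (fun j _ => (hm j).aestronglyMeasurable) hp).trans
    (ENNReal.sum_le_tsum _)

/-- The norm of `t ↦ t ^ a * h t` in `L^p((0, ∞), dt / t)`, with the density `1 / t` moved into
the power. -/
noncomputable def powerNorm (a p : ℝ) (h : ℝ → ℝ≥0∞) : ℝ≥0∞ :=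
  eLpNorm' (fun t => ENNReal.ofReal (t ^ (a - 1 / p)) * h t) p (volume.restrict (Ioi 0))

theorem powerNorm_mono {a p : ℝ} (hp : 0 < p) {h k : ℝ → ℝ≥0∞}
    (hhk : ∀ t, 0 < t → h t ≤ k t) : powerNorm a p h ≤ powerNorm a p k := by
  refine eLpNorm'_mono_enorm_ae hp.le ?_
  filter_upwards [ae_restrict_mem measurableSet_Ioi] with t ht
  simp only [enorm_eq_self]
  gcongr
  exact hhk t ht

theorem powerNorm_tsum_le {a p : ℝ} (hp : 1 ≤ p) {h : ℕ → ℝ → ℝ≥0∞}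
    (hm : ∀ j, Measurable (h j)) :
    powerNorm a p (fun t => ∑' j, h j t) ≤ ∑' j, powerNorm a p (h j) := by
  simp only [powerNorm, ← ENNReal.tsum_mul_left]
  refine eLpNorm'_tsum_le (h := fun j t => ENNReal.ofReal (t ^ (a - 1 / p)) * h j t)
    (fun j => ?_) hp
  exact (ENNReal.measurable_ofReal.comp (measurable_id.pow_const _)).mul (hm j)

theorem powerNorm_const_mul {a p : ℝ} (hp : 0 < p) {k : ℝ≥0∞} (hk : k ≠ ∞) (h : ℝ → ℝ≥0∞) :
    powerNorm a p (fun t => k * h t) = k * powerNorm a p h := by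
  simp only [powerNorm, eLpNorm', enorm_eq_self, mul_left_comm _ k]
  simp only [ENNReal.mul_rpow_of_nonneg k _ hp.le]
  rw [lintegral_const_mul' _ _ (ENNReal.rpow_ne_top_of_nonneg hp.le hk),
    ENNReal.mul_rpow_of_nonneg _ _ (by positivity), ← ENNReal.rpow_mul,
    mul_one_div_cancel hp.ne', ENNReal.rpow_one]

theorem powerNorm_comp_mul_left {a p l : ℝ} (hp : 0 < p) (hl : 0 < l) (h : ℝ → ℝ≥0∞) :
    powerNorm a p (fun t => h (l * t)) = ENNReal.ofReal (l ^ (-a)) * powerNorm a p h := by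
  have h1 : powerNorm a p (fun t => h (l * t)) = ENNReal.ofReal (l ^ (-(a - 1 / p))) *
      eLpNorm' (fun t => ENNReal.ofReal ((l * t) ^ (a - 1 / p)) * h (l * t)) p
        (volume.restrict (Ioi 0)) := by
    have := powerNorm_const_mul (a := a) hp (k := ENNReal.ofReal (l ^ (a - 1 / p)))
      ENNReal.ofReal_ne_top (fun t => h (l * t))
    have h2 : eLpNorm' (fun t => ENNReal.ofReal ((l * t) ^ (a - 1 / p)) * h (l * t)) p
        (volume.restrict (Ioi 0)) = ENNReal.ofReal (l ^ (a - 1 / p)) *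
          powerNorm a p (fun t => h (l * t)) := by
      rw [← this]
      refine eLpNorm'_congr_ae ?_
      filter_upwards [ae_restrict_mem measurableSet_Ioi] with t ht
      rw [Real.mul_rpow hl.le (le_of_lt ht), ENNReal.ofReal_mul (by positivity)]
      ring
    rw [h2, ← mul_assoc, ← ENNReal.ofReal_mul (by positivity), ← Real.rpow_add hl]
    simp
  rw [h1]
  simp only [powerNorm, eLpNorm', enorm_eq_self]
  rw [lintegral_Ioi_comp_mul_left hl
    (fun t => (ENNReal.ofReal (t ^ (a - 1 / p)) * h t) ^ p),
    ENNReal.mul_rpow_of_nonneg _ _ (by positivity), ← mul_assoc,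
    ENNReal.ofReal_rpow_of_pos (by positivity), ← ENNReal.ofReal_mul (by positivity),
    Real.inv_rpow hl.le, ← Real.rpow_neg hl.le, ← Real.rpow_add hl]
  congr 4
  ring

/-- A power weight shifts the exponent of `powerNorm`. -/
theorem powerNorm_rpow_mul {a p e : ℝ} (h : ℝ → ℝ≥0∞) :
    powerNorm a p (fun t => ENNReal.ofReal (t ^ e) * h t) = powerNorm (a + e) p h := by
  refine eLpNorm'_congr_ae ?_
  filter_upwards [ae_restrict_mem measurableSet_Ioi] with t ht
  rw [← mul_assoc, ← ENNReal.ofReal_mul (by have : 0 < t := ht; positivity),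
    ← Real.rpow_add ht]
  congr 3
  ring

theorem powerNorm_one_div (p : ℝ) (h : ℝ → ℝ≥0∞) :
    powerNorm (1 / p) p h = eLpNorm' h p (volume.restrict (Ioi 0)) := by
  simp [powerNorm]

theorem powerNorm_one_div_rearrangement_le {X : Type*} [MeasurableSpace X] {μ : Measure X}
    {f : X → ℝ} (hf : AEStronglyMeasurable f μ) {p : ℝ≥0∞} (hp : p ≠ 0) (hp' : p ≠ ∞) :
    powerNorm (1 / p.toReal) p.toReal (rearrangement f μ) ≤ eLpNorm f p μ := by
  rw [powerNorm_one_div, ← eLpNorm_eq_eLpNorm' hp hp']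
  exact eLpNorm_rearrangement_le hf hp

theorem lorentzNorm_eq_powerNorm {X : Type*} [MeasurableSpace X] {μ : Measure X}
    {f : X → ℝ} {q p : ℝ} (hp : 0 < p) :
    lorentzNorm q p f μ = powerNorm (1 / q) p (maximalRearrangement f μ) := by
  rw [lorentzNorm, powerNorm, eLpNorm']
  congr 1
  refine setLIntegral_congr_fun measurableSet_Ioi fun t ht => ?_
  have ht : 0 < t := ht
  simp only [enorm_eq_self]
  rw [ENNReal.mul_rpow_of_nonneg _ _ hp.le, ENNReal.mul_rpow_of_nonneg _ _ hp.le,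
    ENNReal.div_eq_inv_mul, ← mul_assoc, ← ENNReal.ofReal_inv_of_pos ht,
    ENNReal.ofReal_rpow_of_pos (by positivity), ENNReal.ofReal_rpow_of_pos (by positivity),
    ← ENNReal.ofReal_mul (by positivity), ← Real.rpow_mul ht.le, ← Real.rpow_mul ht.le,
    ← Real.rpow_neg_one, ← Real.rpow_add ht]
  congr 3
  field_simp
  ring

/-- Dyadic decomposition of the average defining `f**`, with `f*` replaced by its value at the left
end of each dyadic interval. -/
theorem maximalRearrangement_le_tsum {X : Type*} [MeasurableSpace X] {μ : Measure X}
    {f : X → ℝ} {t : ℝ} (ht : 0 < t) :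
    maximalRearrangement f μ t ≤
      ∑' j : ℕ, ENNReal.ofReal (2⁻¹ ^ j) * rearrangement f μ (2⁻¹ ^ (j + 1) * t) := by
  rw [maximalRearrangement_eq_lintegral ht]
  have hcov : Ioo (0 : ℝ) 1 ⊆ ⋃ j : ℕ, Icc ((2⁻¹ : ℝ) ^ (j + 1)) (2⁻¹ ^ j) := by
    intro u hu
    obtain ⟨n, h1, h2⟩ := exists_nat_pow_near_of_lt_one hu.1 hu.2.le (by norm_num : (0:ℝ) < 2⁻¹)
      (by norm_num)
    exact mem_iUnion.2 ⟨n, h1.le, h2⟩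
  refine (lintegral_mono_set hcov).trans ((lintegral_iUnion_le _ _).trans ?_)
  refine ENNReal.tsum_le_tsum fun j => ?_
  calc ∫⁻ u in Icc ((2⁻¹ : ℝ) ^ (j + 1)) (2⁻¹ ^ j), rearrangement f μ (t * u)
      ≤ ∫⁻ _ in Icc ((2⁻¹ : ℝ) ^ (j + 1)) (2⁻¹ ^ j), rearrangement f μ (2⁻¹ ^ (j + 1) * t) := by
        refine setLIntegral_mono' measurableSet_Icc fun u hu => rearrangement_antitone ?_
        rw [mul_comm t]
        exact mul_le_mul_of_nonneg_right hu.1 ht.le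
    _ ≤ _ := by
        rw [setLIntegral_const, mul_comm, Real.volume_Icc]
        gcongr
        simp

/-- A geometric series with ratio `2 ^ (-e)`, `e > 0`, has a finite sum. -/
theorem exists_tsum_ofReal_rpow_le {e : ℝ} (he : 0 < e) :
    ∃ C : ℝ≥0, ∑' j : ℕ, ENNReal.ofReal (((2 : ℝ)⁻¹ ^ j) ^ e) ≤ C := by
  have hlt : ENNReal.ofReal ((2 : ℝ)⁻¹ ^ e) < 1 := by
    rw [← ENNReal.ofReal_one, ENNReal.ofReal_lt_ofReal_iff one_pos]
    exact Real.rpow_lt_one (by norm_num) (by norm_num) he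
  have h : ∑' j : ℕ, ENNReal.ofReal (((2 : ℝ)⁻¹ ^ j) ^ e) ≠ ∞ := by
    have : ∀ j : ℕ, ENNReal.ofReal (((2 : ℝ)⁻¹ ^ j) ^ e) = ENNReal.ofReal ((2 : ℝ)⁻¹ ^ e) ^ j := by
      intro j
      rw [← ENNReal.ofReal_pow (by positivity), Real.rpow_pow_comm (by norm_num)]
    simp only [this]
    rw [ENNReal.tsum_geometric]
    exact ENNReal.inv_ne_top.2 (tsub_pos_of_lt hlt).ne'
  exact ⟨_, (ENNReal.coe_toNNReal h).ge⟩

/-- **Hardy's inequality** for the averages `f**` of `f*`. -/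
theorem exists_powerNorm_maximalRearrangement_le {a p : ℝ} (ha : a < 1) (hp : 1 ≤ p) :
    ∃ C : ℝ≥0, ∀ (X : Type*) [MeasurableSpace X] (μ : Measure X) (f : X → ℝ),
      powerNorm a p (maximalRearrangement f μ) ≤ C * powerNorm a p (rearrangement f μ) := by
  have hp0 : 0 < p := by linarith
  obtain ⟨C, hC⟩ := exists_tsum_ofReal_rpow_le (sub_pos.2 ha)
  refine ⟨C * (2 ^ a : ℝ).toNNReal, fun X _ μ f => ?_⟩
  refine (powerNorm_mono hp0 fun t ht => maximalRearrangement_le_tsum ht).trans ?_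
  refine (powerNorm_tsum_le hp fun j => ?_).trans ?_
  · exact (measurable_rearrangement.comp (measurable_const_mul _)).const_mul _
  have h : ∀ j : ℕ, powerNorm a p (fun t => ENNReal.ofReal (2⁻¹ ^ j) *
      rearrangement f μ (2⁻¹ ^ (j + 1) * t)) = ENNReal.ofReal (((2 : ℝ)⁻¹ ^ j) ^ (1 - a)) *
        (ENNReal.ofReal (2 ^ a) * powerNorm a p (rearrangement f μ)) := by
    intro j
    rw [powerNorm_const_mul hp0 ENNReal.ofReal_ne_top,
      powerNorm_comp_mul_left hp0 (by positivity), ← mul_assoc, ← mul_assoc,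
      ← ENNReal.ofReal_mul (by positivity), ← ENNReal.ofReal_mul (by positivity)]
    congr 2
    rw [pow_succ, Real.mul_rpow (by positivity) (by positivity), Real.inv_rpow (by norm_num),
      Real.rpow_neg (x := 2) (by norm_num) a, inv_inv,
      sub_eq_add_neg, Real.rpow_add (by positivity), Real.rpow_one]
    ring
  simp only [h]
  rw [ENNReal.tsum_mul_right, ← mul_assoc, ENNReal.coe_mul]
  gcongr
  exact le_rfl

end PowerNorm

/-! ### The discrete Hardy inequality -/

section Hardy

/-- Bernoulli-type bound valid for all exponents `r > 0`, with slope `1` when `r ≥ 1` and `r`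
otherwise. -/
theorem one_sub_rpow_le {x r : ℝ} (hx0 : 0 ≤ x) (hx1 : x ≤ 1) (hr : 0 < r) :
    (1 - x) ^ r ≤ 1 - min 1 r * x := by
  rcases le_total r 1 with h | h
  · rw [min_eq_right h]
    have := rpow_one_add_le_one_add_mul_self (s := -x) (by linarith) hr.le h
    linarith [show (1 - x) ^ r = (1 + -x) ^ r by rw [← sub_eq_add_neg]]
  · rw [min_eq_left h, one_mul]
    exact (Real.rpow_le_rpow_of_exponent_ge' (by linarith) (by linarith) zero_le_one h).trans
      (by simp)

/-- One step of the discrete Hardy inequality: the potential `m ^ (1 - p) * F ^ p` absorbs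
`(F / m) ^ p` when `m` grows by one, up to the increment `a`. -/
theorem rpow_add_step_le {p m F a : ℝ} (hp : 1 < p) (hm : 1 ≤ m) (hF : 0 ≤ F) (ha : 0 ≤ a) :
    (m + 1) ^ (1 - p) * (F + a) ^ p + min 1 (p - 1) / 4 * (F / m) ^ p ≤
      m ^ (1 - p) * F ^ p + 2 ^ (p - 1) * a ^ p := by
  have hm0 : 0 < m := by linarith
  have hmin : 0 ≤ min 1 (p - 1) := le_min zero_le_one (by linarith)
  -- Convexity with the weights `2m / (2m + 1)` and `1 / (2m + 1)`.
  have hconv : (F + a) ^ p ≤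
      (2 * m / (2 * m + 1)) ^ (1 - p) * F ^ p + (2 * m + 1) ^ (p - 1) * a ^ p := by
    have h := (convexOn_rpow hp.le).2
      (show F / (2 * m / (2 * m + 1)) ∈ Ici 0 from mem_Ici.2 (by positivity))
      (show a * (2 * m + 1) ∈ Ici 0 from mem_Ici.2 (by positivity))
      (show 0 ≤ 2 * m / (2 * m + 1) by positivity) (show 0 ≤ 1 / (2 * m + 1) by positivity)
      (by field_simp)
    simp only [smul_eq_mul] at h
    have e1 : 2 * m / (2 * m + 1) * (F / (2 * m / (2 * m + 1))) + 1 / (2 * m + 1) *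
        (a * (2 * m + 1)) = F + a := by field_simp
    rw [e1, Real.div_rpow hF (by positivity), Real.mul_rpow ha (by positivity)] at h
    refine h.trans (le_of_eq ?_)
    rw [Real.rpow_sub (by positivity), Real.rpow_one, Real.rpow_sub (by positivity),
      Real.rpow_one]
    ring
  have hx : (1 - 1 / (2 * (m + 1))) ^ (p - 1) ≤ 1 - min 1 (p - 1) * (1 / (2 * (m + 1))) := by
    refine one_sub_rpow_le (by positivity) ?_ (by linarith)
    rw [div_le_one (by positivity)]; linarith
  have hcF : (m + 1) ^ (1 - p) * (2 * m / (2 * m + 1)) ^ (1 - p) =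
      m ^ (1 - p) * (1 - 1 / (2 * (m + 1))) ^ (p - 1) := by
    have e2 : (m + 1) * (2 * m / (2 * m + 1)) = m * (1 - 1 / (2 * (m + 1)))⁻¹ := by
      have : 1 - 1 / (2 * (m + 1)) = (2 * m + 1) / (2 * (m + 1)) := by field_simp; ring
      rw [this, inv_div]; ring
    have hpos : 0 < 1 - 1 / (2 * (m + 1)) := by
      rw [sub_pos, div_lt_one (by positivity)]; linarith
    rw [← Real.mul_rpow (by positivity) (by positivity), e2, Real.mul_rpow hm0.le (by positivity),
      Real.inv_rpow hpos.le, ← Real.rpow_neg hpos.le]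
    congr 2; ring
  have hca : (m + 1) ^ (1 - p) * (2 * m + 1) ^ (p - 1) ≤ 2 ^ (p - 1) := by
    rw [show 1 - p = -(p - 1) by ring, Real.rpow_neg (by positivity),
      ← Real.inv_rpow (by positivity), ← Real.mul_rpow (by positivity) (by positivity)]
    refine Real.rpow_le_rpow (by positivity) ?_ (by linarith)
    rw [inv_mul_le_iff₀ (by positivity)]; linarith
  have hFm : (F / m) ^ p = m ^ (1 - p) * F ^ p / m := by
    rw [Real.div_rpow hF hm0.le, Real.rpow_sub hm0, Real.rpow_one]
    field_simp
  have hkey : min 1 (p - 1) / 4 / m ≤ min 1 (p - 1) * (1 / (2 * (m + 1))) := by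
    rw [div_div, div_eq_mul_one_div]
    refine mul_le_mul_of_nonneg_left ?_ hmin
    exact one_div_le_one_div_of_le (by positivity) (by linarith)
  have hnn : 0 ≤ m ^ (1 - p) * F ^ p := by positivity
  calc (m + 1) ^ (1 - p) * (F + a) ^ p + min 1 (p - 1) / 4 * (F / m) ^ p
      ≤ (m + 1) ^ (1 - p) * ((2 * m / (2 * m + 1)) ^ (1 - p) * F ^ p +
          (2 * m + 1) ^ (p - 1) * a ^ p) + min 1 (p - 1) / 4 * (F / m) ^ p := by gcongr
    _ = (m + 1) ^ (1 - p) * (2 * m / (2 * m + 1)) ^ (1 - p) * F ^ p +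
          (m + 1) ^ (1 - p) * (2 * m + 1) ^ (p - 1) * a ^ p +
          min 1 (p - 1) / 4 / m * (m ^ (1 - p) * F ^ p) := by rw [hFm]; ring
    _ ≤ m ^ (1 - p) * (1 - min 1 (p - 1) * (1 / (2 * (m + 1)))) * F ^ p + 2 ^ (p - 1) * a ^ p +
          min 1 (p - 1) * (1 / (2 * (m + 1))) * (m ^ (1 - p) * F ^ p) := by
        rw [hcF]; gcongr
    _ = _ := by ring

/-- The sum of the steps `rpow_add_step_le`; the potential on the left is kept so that the
induction closes. -/
theorem sum_rpow_div_le {p : ℝ} (hp : 1 < p) {F a : ℕ → ℝ} (hF : ∀ n, 0 ≤ F n)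
    (ha : ∀ n, 0 ≤ a n) (h : ∀ n, F (n + 1) ≤ F n + a n) (M : ℕ) :
    ((M : ℝ) + 1) ^ (1 - p) * F M ^ p +
        min 1 (p - 1) / 4 * ∑ n ∈ Finset.range M, (F n / (n + 1)) ^ p ≤
      F 0 ^ p + 2 ^ (p - 1) * ∑ n ∈ Finset.range M, a n ^ p := by
  induction M with
  | zero => simp
  | succ M ih =>
    have h1 := rpow_add_step_le (m := M + 1) hp (by simp) (hF M) (ha M)
    have h2 : F (M + 1) ^ p ≤ (F M + a M) ^ p :=
      Real.rpow_le_rpow (hF _) (h M) (by linarith)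
    have h3 : ((M : ℝ) + 1 + 1) ^ (1 - p) * F (M + 1) ^ p ≤
        ((M : ℝ) + 1 + 1) ^ (1 - p) * (F M + a M) ^ p := by gcongr
    rw [Finset.sum_range_succ, Finset.sum_range_succ]
    push_cast
    linarith

/-- **Hardy's inequality**, in discrete form: if the increments of `F` are bounded by a
sequence in `ℓ^p`, `p > 1`, then `F n / (n + 1)` is in `ℓ^p`. -/
theorem exists_tsum_rpow_div_le {p : ℝ} (hp : 1 < p) :
    ∃ C : ℝ≥0, ∀ F a : ℕ → ℝ≥0∞, (∀ n, F (n + 1) ≤ F n + a n) →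
      ∑' n : ℕ, (F n / (n + 1)) ^ p ≤ C * (F 0 ^ p + ∑' n, a n ^ p) := by
  have hp0 : 0 < p := by linarith
  have hk : 0 < min 1 (p - 1) / 4 := by
    have : 0 < min 1 (p - 1) := lt_min one_pos (by linarith)
    positivity
  set k := min 1 (p - 1) / 4 with hkdef
  have hC0 : 0 < k⁻¹ * 2 ^ (p - 1) := by positivity
  refine ⟨(k⁻¹ * 2 ^ (p - 1)).toNNReal, fun F a h => ?_⟩
  change _ ≤ ENNReal.ofReal (k⁻¹ * 2 ^ (p - 1)) * _
  -- If the right-hand side is finite, so are all terms, and the inequality is one of real numbers.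
  rcases eq_or_ne (F 0 ^ p + ∑' n, a n ^ p) ∞ with htop | htop
  · rw [htop, ENNReal.mul_top (by simpa using hC0)]
    exact le_top
  rw [ENNReal.add_ne_top] at htop
  have ha : ∀ n, a n ≠ ∞ := fun n hn => ENNReal.ne_top_of_tsum_ne_top htop.2 n
    (by rw [hn, ENNReal.top_rpow_of_pos hp0])
  have hF : ∀ n, F n ≠ ∞ := by
    intro n
    induction n with
    | zero => exact fun hn => htop.1 (by rw [hn, ENNReal.top_rpow_of_pos hp0])
    | succ n ih => exact ne_top_of_le_ne_top (ENNReal.add_ne_top.2 ⟨ih, ha n⟩) (h n)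
  have hFr : ∀ n, F n = ENNReal.ofReal (F n).toReal := fun n => (ENNReal.ofReal_toReal (hF n)).symm
  have har : ∀ n, a n = ENNReal.ofReal (a n).toReal := fun n => (ENNReal.ofReal_toReal (ha n)).symm
  rw [ENNReal.tsum_eq_iSup_nat]
  refine iSup_le fun M => ?_
  have hreal := sum_rpow_div_le hp (F := fun n => (F n).toReal) (a := fun n => (a n).toReal)
    (fun n => ENNReal.toReal_nonneg) (fun n => ENNReal.toReal_nonneg)
    (fun n => by
      rw [← ENNReal.toReal_add (hF n) (ha n)]
      exact ENNReal.toReal_mono (ENNReal.add_ne_top.2 ⟨hF n, ha n⟩) (h n)) M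
  have hpow1 : (1 : ℝ) ≤ 2 ^ (p - 1) := Real.one_le_rpow (by norm_num) (by linarith)
  have hF0 : 0 ≤ (F 0).toReal ^ p := by positivity
  have hsum : ∑ n ∈ Finset.range M, ((F n).toReal / (n + 1)) ^ p ≤ k⁻¹ * 2 ^ (p - 1) *
      ((F 0).toReal ^ p + ∑ n ∈ Finset.range M, (a n).toReal ^ p) := by
    rw [mul_assoc, ← div_eq_inv_mul, le_div_iff₀' hk]
    have : 0 ≤ ((M : ℝ) + 1) ^ (1 - p) * (F M).toReal ^ p := by positivity
    rw [← hkdef] at hreal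
    nlinarith [mul_nonneg (sub_nonneg.2 hpow1) hF0]
  have e1 : ∑ n ∈ Finset.range M, (F n / (n + 1)) ^ p =
      ENNReal.ofReal (∑ n ∈ Finset.range M, ((F n).toReal / (n + 1)) ^ p) := by
    rw [ENNReal.ofReal_sum_of_nonneg (fun n _ => by positivity)]
    refine Finset.sum_congr rfl fun n _ => ?_
    rw [← ENNReal.ofReal_rpow_of_nonneg (by positivity) hp0.le,
      ENNReal.ofReal_div_of_pos (by positivity), ← hFr]
    congr 2
    rw [ENNReal.ofReal_add (by positivity) zero_le_one]
    simp
  have e2 : F 0 ^ p + ∑ n ∈ Finset.range M, a n ^ p =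
      ENNReal.ofReal ((F 0).toReal ^ p + ∑ n ∈ Finset.range M, (a n).toReal ^ p) := by
    rw [ENNReal.ofReal_add (by positivity) (Finset.sum_nonneg fun n _ => by positivity),
      ENNReal.ofReal_sum_of_nonneg (fun n _ => by positivity),
      ← ENNReal.ofReal_rpow_of_nonneg (by positivity) hp0.le, ← hFr]
    congr 1
    refine Finset.sum_congr rfl fun n _ => ?_
    rw [← ENNReal.ofReal_rpow_of_nonneg (by positivity) hp0.le, ← har]
  calc ∑ n ∈ Finset.range M, (F n / (n + 1)) ^ p
      ≤ ENNReal.ofReal (k⁻¹ * 2 ^ (p - 1)) * (F 0 ^ p + ∑ n ∈ Finset.range M, a n ^ p) := by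
        rw [e1, e2, ← ENNReal.ofReal_mul hC0.le]
        exact ENNReal.ofReal_le_ofReal hsum
    _ ≤ _ := by gcongr; exact ENNReal.sum_le_tsum _

end Hardy

/-! ### The embeddings -/

section Embedding

variable {p : ℝ≥0∞} {s α b c : ℝ}

theorem ne_top_of_lt_toReal_one_div {x : ℝ} (hx : 0 < x) (h : x ≤ (1 / p).toReal) : p ≠ ∞ := by
  rintro rfl
  simp at h
  linarith

/-- Iteration of the dyadic inequality up to infinity. The remainder `f*(2 ^ n * t)` tends to zero
because `f ∈ L^p` with `p < ∞`. -/
theorem rearrangement_le_tsum {Ω : Type*} [MetricSpace Ω] [MeasurableSpace Ω] {μ : Measure Ω}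
    {f g : Ω → ℝ} (hs : 0 < s) (hα : 0 < α) (hb : 0 < b) (hc : 1 ≤ c) (hp : 1 ≤ p) (hp' : p ≠ ∞)
    (hac : IsAlmostContinuous c μ) (hlb : IsLowerBounded α b μ) (hf : MemLp f p μ)
    (hg : g ∈ gradients s f μ) {t : ℝ} (ht : 0 < t) :
    rearrangement f μ t ≤ ∑' k : ℕ, ENNReal.ofReal (2 * (6 * c / b) ^ (s / α)) *
      (ENNReal.ofReal ((2 ^ k * t) ^ (s / α)) * rearrangement g μ (2 ^ k * t)) := by
  set D := 2 * (6 * c / b) ^ (s / α) with hD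
  have hD0 : 0 ≤ D := by positivity
  set T : ℕ → ℝ≥0∞ := fun k => ENNReal.ofReal D *
      (ENNReal.ofReal ((2 ^ k * t) ^ (s / α)) * rearrangement g μ (2 ^ k * t)) with hT
  have hfin : ∀ n : ℕ, rearrangement f μ t ≤ rearrangement f μ (2 ^ n * t) +
      ∑ k ∈ Finset.range n, T k := by
    intro n
    induction n with
    | zero => simp
    | succ n ih =>
      have h := rearrangement_le_rearrangement_two_mul_add hs hα hb hc hac hlb hg
        (t := 2 ^ n * t) (by positivity)
      rw [← hD, ENNReal.ofReal_mul hD0, mul_assoc, ← mul_assoc 2, ← pow_succ'] at h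
      rw [Finset.sum_range_succ, add_comm (∑ k ∈ Finset.range n, T k), ← add_assoc]
      exact ih.trans (by gcongr)
  have hpr : 0 < (1 / p).toReal := by
    rw [ENNReal.toReal_div, ENNReal.toReal_one]
    exact one_div_pos.2 (ENNReal.toReal_pos (zero_lt_one.trans_le hp).ne' hp')
  have hlim : Filter.Tendsto (fun n : ℕ => ENNReal.ofReal ((2 ^ n * t) ^ (-(1 / p).toReal)) *
      eLpNorm f p μ + ∑' k, T k) Filter.atTop (nhds (0 + ∑' k, T k)) := by
    refine Filter.Tendsto.add ?_ tendsto_const_nhds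
    rw [← zero_mul (eLpNorm f p μ), ← ENNReal.ofReal_zero]
    refine ENNReal.Tendsto.mul_const (ENNReal.tendsto_ofReal ?_) (Or.inr hf.2.ne)
    refine (tendsto_rpow_neg_atTop hpr).comp ?_
    exact (tendsto_pow_atTop_atTop_of_one_lt one_lt_two).atTop_mul_const ht
  rw [zero_add] at hlim
  refine ge_of_tendsto' hlim fun n => (hfin n).trans ?_
  gcongr
  · exact rearrangement_le_eLpNorm hf.1 hp (by positivity)
  · exact ENNReal.sum_le_tsum _

/-- The subcritical case: the embedding into a Lorentz space. The constants come from two geometric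
series, with ratios `2 ^ (-a)` and `2 ^ (a - 1)` for `a = 1 / p - s / α`, which lies in `(0, 1)`. -/
theorem exists_lorentzNorm_le (hs : 0 < s) (hα : 0 < α) (hb : 0 < b) (hc : 1 ≤ c) (hp : 1 ≤ p)
    (hsp : s / α < (1 / p).toReal) :
    ∃ C : ℝ≥0, ∀ (Ω : Type*) [MetricSpace Ω] [MeasurableSpace Ω] (μ : Measure Ω),
      IsAlmostContinuous c μ → IsLowerBounded α b μ → ∀ f : Ω → ℝ, MemLp f p μ →
      ∀ g ∈ gradients s f μ,
        lorentzNorm (α * p.toReal / (α - s * p.toReal)) p.toReal f μ ≤ C * eLpNorm g p μ := by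
  have hσ : 0 < s / α := by positivity
  have hp' : p ≠ ∞ := ne_top_of_lt_toReal_one_div hσ hsp.le
  have hp0 : p ≠ 0 := (zero_lt_one.trans_le hp).ne'
  have hpr1 : 1 ≤ p.toReal := by
    rw [← ENNReal.toReal_one]; exact ENNReal.toReal_mono hp' hp
  have hpr : 0 < p.toReal := by linarith
  rw [ENNReal.toReal_div, ENNReal.toReal_one] at hsp
  set a := 1 / p.toReal - s / α with ha
  have ha0 : 0 < a := sub_pos.2 hsp
  have ha1 : a < 1 := by
    have : 1 / p.toReal ≤ 1 := by rw [div_le_one hpr]; exact hpr1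
    linarith
  have hq : 1 / (α * p.toReal / (α - s * p.toReal)) = a := by
    rw [ha, one_div_div]; field_simp
  obtain ⟨C₁, hC₁⟩ := exists_powerNorm_maximalRearrangement_le ha1 hpr1
  obtain ⟨C₂, hC₂⟩ := exists_tsum_ofReal_rpow_le ha0
  set D := 2 * (6 * c / b) ^ (s / α) with hD
  refine ⟨C₁ * (C₂ * D.toNNReal), fun Ω _ _ μ hac hlb f hf g hg => ?_⟩
  rw [lorentzNorm_eq_powerNorm hpr, hq]
  refine (hC₁ Ω μ f).trans ?_
  push_cast
  rw [mul_assoc]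
  gcongr
  refine (powerNorm_mono hpr fun t ht =>
    rearrangement_le_tsum hs hα hb hc hp hp' hac hlb hf hg ht).trans ?_
  have hmeas : Measurable fun t : ℝ => ENNReal.ofReal (t ^ (s / α)) * rearrangement g μ t :=
    (ENNReal.measurable_ofReal.comp (measurable_id.pow_const _)).mul measurable_rearrangement
  refine (powerNorm_tsum_le hpr1 fun k => ?_).trans ?_
  · exact (hmeas.comp (measurable_const_mul ((2 : ℝ) ^ k))).const_mul _
  have hterm : ∀ k : ℕ, powerNorm a p.toReal (fun t => ENNReal.ofReal D *
      (ENNReal.ofReal ((2 ^ k * t) ^ (s / α)) * rearrangement g μ (2 ^ k * t))) ≤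
      ENNReal.ofReal (((2 : ℝ)⁻¹ ^ k) ^ a) * (ENNReal.ofReal D * eLpNorm g p μ) := by
    intro k
    rw [powerNorm_const_mul hpr ENNReal.ofReal_ne_top,
      powerNorm_comp_mul_left hpr (by positivity : (0 : ℝ) < 2 ^ k)
        (fun t => ENNReal.ofReal (t ^ (s / α)) * rearrangement g μ t),
      powerNorm_rpow_mul, ha, sub_add_cancel, mul_left_comm, ← ha, Real.rpow_neg (by positivity),
      ← Real.inv_rpow (by positivity), inv_pow]
    gcongr
    exact powerNorm_one_div_rearrangement_le hg.1 hp0 hp'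
  refine (ENNReal.tsum_le_tsum hterm).trans ?_
  rw [ENNReal.tsum_mul_right, mul_assoc]
  gcongr
  exact le_rfl

/-- The supercritical case: `f` is bounded, by iterating the dyadic inequality from `t = 1` down
to zero. -/
theorem exists_eLpNorm_top_le (hs : 0 < s) (hα : 0 < α) (hb : 0 < b) (hc : 1 ≤ c) (hp : 1 ≤ p)
    (hsp : (1 / p).toReal < s / α) :
    ∃ C : ℝ≥0, ∀ (Ω : Type*) [MetricSpace Ω] [MeasurableSpace Ω] (μ : Measure Ω),
      IsAlmostContinuous c μ → IsLowerBounded α b μ → ∀ f : Ω → ℝ, MemLp f p μ →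
      ∀ g ∈ gradients s f μ, eLpNorm f ∞ μ ≤ C * (eLpNorm g p μ + sumNorm f μ) := by
  set e := s / α - (1 / p).toReal with he
  have he0 : 0 < e := sub_pos.2 hsp
  obtain ⟨C, hC⟩ := exists_tsum_ofReal_rpow_le he0
  set D := 2 * (6 * c / b) ^ (s / α) with hD
  have hD0 : 0 ≤ D := by positivity
  refine ⟨C * D.toNNReal + 1, fun Ω _ _ μ hac hlb f hf g hg => ?_⟩
  set T : ℕ → ℝ≥0∞ := fun k =>
    ENNReal.ofReal (((2 : ℝ)⁻¹ ^ k) ^ e) * (ENNReal.ofReal D * eLpNorm g p μ) with hT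
  have hfin : ∀ n : ℕ, rearrangement f μ ((2 : ℝ)⁻¹ ^ n) ≤
      rearrangement f μ 1 + ∑ k ∈ Finset.range n, T k := by
    intro n
    induction n with
    | zero => simp
    | succ n ih =>
      have h0 : (0 : ℝ) < 2⁻¹ ^ (n + 1) := by positivity
      have h := rearrangement_le_rearrangement_two_mul_add hs hα hb hc hac hlb hg h0
      rw [show (2 : ℝ) * 2⁻¹ ^ (n + 1) = 2⁻¹ ^ n by rw [pow_succ]; ring] at h
      rw [Finset.sum_range_succ, ← add_assoc]
      refine h.trans (add_le_add ih ?_)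
      calc ENNReal.ofReal (D * (2⁻¹ ^ (n + 1)) ^ (s / α)) * rearrangement g μ (2⁻¹ ^ (n + 1))
          ≤ ENNReal.ofReal (D * (2⁻¹ ^ (n + 1)) ^ (s / α)) *
            (ENNReal.ofReal ((2⁻¹ ^ (n + 1)) ^ (-(1 / p).toReal)) * eLpNorm g p μ) := by
            gcongr
            exact rearrangement_le_eLpNorm hg.1 hp h0
        _ = ENNReal.ofReal (((2 : ℝ)⁻¹ ^ (n + 1)) ^ e) * (ENNReal.ofReal D * eLpNorm g p μ) := by
            rw [← mul_assoc, ← mul_assoc, ← ENNReal.ofReal_mul (by positivity),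
              ← ENNReal.ofReal_mul (by positivity), mul_assoc D, ← Real.rpow_add h0, mul_comm D,
              ← sub_eq_add_neg]
        _ ≤ T n := by
            simp only [hT]
            gcongr ENNReal.ofReal (?_ ^ e) * _
            exact pow_le_pow_of_le_one (by norm_num) (by norm_num) n.le_succ
  refine eLpNorm_top_le_of_rearrangement_le fun n => (hfin n).trans ?_
  calc rearrangement f μ 1 + ∑ k ∈ Finset.range n, T k
      ≤ sumNorm f μ + C * (ENNReal.ofReal D * eLpNorm g p μ) := by
        gcongr
        · exact (rearrangement_le_maximalRearrangement one_pos).trans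
            (maximalRearrangement_one_le_sumNorm hf.1)
        · refine (ENNReal.sum_le_tsum _).trans ?_
          rw [hT, ENNReal.tsum_mul_right]
          gcongr
    _ = 1 * sumNorm f μ + C * D.toNNReal * eLpNorm g p μ := by
        rw [one_mul, mul_assoc]; rfl
    _ ≤ ((C * D.toNNReal + 1 : ℝ≥0) : ℝ≥0∞) * (eLpNorm g p μ + sumNorm f μ) := by
        push_cast
        rw [mul_add, add_comm]
        gcongr
        · exact le_self_add
        · exact le_add_self

/-- The case `s = α`, from the oscillation estimate and `g**(t) ≤ t ^ (-1 / p) ‖g‖_p`. -/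
theorem exists_iSup_oscillation_le (hs : 0 < s) (hα : 0 < α) (hb : 0 < b) (hc : 1 ≤ c)
    (hp : 1 ≤ p) (hσ : s / α = 1) :
    ∃ C : ℝ≥0, ∀ (Ω : Type*) [MetricSpace Ω] [MeasurableSpace Ω] (μ : Measure Ω),
      IsAlmostContinuous c μ → IsLowerBounded α b μ → ∀ f : Ω → ℝ, MemLp f p μ →
      ∀ g ∈ gradients s f μ, (⨆ (t : ℝ) (_ : 0 < t), ENNReal.ofReal (t ^ (1 / p).toReal) *
        (oscillation f μ t / ENNReal.ofReal t)) ≤ C * eLpNorm g p μ := by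
  refine ⟨(2 * (3 * c / b)).toNNReal, fun Ω _ _ μ hac hlb f hf g hg => ?_⟩
  refine iSup_le fun t => iSup_le fun ht => ?_
  have h := oscillation_le_maximalRearrangement hs hα hb hc hac hlb hf.1 hg ht
  rw [hσ, Real.rpow_one, Real.rpow_one] at h
  have h2 : oscillation f μ t / ENNReal.ofReal t ≤ ENNReal.ofReal (2 * (3 * c / b)) *
      (ENNReal.ofReal (t ^ (-(1 / p).toReal)) * eLpNorm g p μ) := by
    refine ENNReal.div_le_of_le_mul (h.trans ?_)
    rw [ENNReal.ofReal_mul (by positivity), mul_right_comm]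
    gcongr
    exact maximalRearrangement_le_eLpNorm hg.1 hp ht
  calc ENNReal.ofReal (t ^ (1 / p).toReal) * (oscillation f μ t / ENNReal.ofReal t)
      ≤ ENNReal.ofReal (t ^ (1 / p).toReal) * (ENNReal.ofReal (2 * (3 * c / b)) *
      (ENNReal.ofReal (t ^ (-(1 / p).toReal)) * eLpNorm g p μ)) := by gcongr
    _ = ENNReal.ofReal (2 * (3 * c / b)) * ((ENNReal.ofReal (t ^ (1 / p).toReal) *
      ENNReal.ofReal (t ^ (-(1 / p).toReal))) * eLpNorm g p μ) := by ring
    _ = ENNReal.ofReal (2 * (3 * c / b)) * eLpNorm g p μ := by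
      rw [← ENNReal.ofReal_mul (by positivity), ← Real.rpow_add ht]
      simp
    _ ≤ _ := le_rfl

/-- Since `g**` is decreasing, its dyadic `L^p` sum is bounded by its `L^p` norm. -/
theorem tsum_ofReal_mul_rpow_maximalRearrangement_le {X : Type*} [MeasurableSpace X]
    {μ : Measure X} {g : X → ℝ} {r : ℝ} (hr : 0 < r) :
    ∑' n : ℕ, ENNReal.ofReal (2⁻¹ ^ n) * maximalRearrangement g μ (2⁻¹ ^ n) ^ r ≤
      2 * powerNorm (1 / r) r (maximalRearrangement g μ) ^ r := by
  have hpow : Antitone fun n : ℕ => (2 : ℝ)⁻¹ ^ n :=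
    fun m n hmn => pow_le_pow_of_le_one (by norm_num) (by norm_num) hmn
  rw [powerNorm_one_div, eLpNorm', ← ENNReal.rpow_mul, one_div_mul_cancel hr.ne',
    ENNReal.rpow_one]
  simp only [enorm_eq_self]
  calc ∑' n : ℕ, ENNReal.ofReal (2⁻¹ ^ n) * maximalRearrangement g μ (2⁻¹ ^ n) ^ r
      ≤ ∑' n : ℕ, 2 * ∫⁻ t in Ioc ((2 : ℝ)⁻¹ ^ (n + 1)) (2⁻¹ ^ n),
          maximalRearrangement g μ t ^ r := by
        refine ENNReal.tsum_le_tsum fun n => ?_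
        calc ENNReal.ofReal (2⁻¹ ^ n) * maximalRearrangement g μ (2⁻¹ ^ n) ^ r
            = 2 * ∫⁻ _ in Ioc ((2 : ℝ)⁻¹ ^ (n + 1)) (2⁻¹ ^ n),
                maximalRearrangement g μ (2⁻¹ ^ n) ^ r := by
              rw [setLIntegral_const, Real.volume_Ioc, mul_comm _ (ENNReal.ofReal _), ← mul_assoc,
                ← ENNReal.ofReal_ofNat 2, ← ENNReal.ofReal_mul (by norm_num)]
              congr 2
              rw [pow_succ]; ring
          _ ≤ _ := by
              gcongr 2 * ?_
              refine setLIntegral_mono' measurableSet_Ioc fun t ht => ?_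
              have ht0 : 0 < t := lt_trans (by positivity) ht.1
              refine ENNReal.rpow_le_rpow ?_ hr.le
              exact maximalRearrangement_antitoneOn ht0 (mem_Ioi.2 (by positivity)) ht.2
    _ = 2 * ∫⁻ t in ⋃ n : ℕ, Ioc ((2 : ℝ)⁻¹ ^ (n + 1)) (2⁻¹ ^ n),
          maximalRearrangement g μ t ^ r := by
        rw [ENNReal.tsum_mul_left, lintegral_iUnion (fun n => measurableSet_Ioc)]
        exact hpow.pairwise_disjoint_on_Ioc_succ
    _ ≤ _ := by
        gcongr
        exact iUnion_subset fun n t ht => lt_trans (by positivity) ht.1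

/-- On `[2 ^ (-j - 1), 2 ^ (-j)]` the measure `dt / t` has mass at most one and the weight
`1 + ln (1 / t)` is at least `(j + 2) / 2`. -/
theorem lintegral_rpow_div_log_le_tsum {X : Type*} [MeasurableSpace X]
    {μ : Measure X} {f : X → ℝ} {r : ℝ} (hr : 0 < r) :
    ∫⁻ t in Ioo (0 : ℝ) 1,
      (maximalRearrangement f μ t / ENNReal.ofReal (1 + Real.log (1 / t))) ^ r /
        ENNReal.ofReal t ≤
      2 ^ r * ∑' n : ℕ, (maximalRearrangement f μ (2⁻¹ ^ n) / (n + 1)) ^ r := by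
  have hcov : Ioo (0 : ℝ) 1 ⊆ ⋃ j : ℕ, Icc ((2⁻¹ : ℝ) ^ (j + 1)) (2⁻¹ ^ j) := by
    intro u hu
    obtain ⟨n, h1, h2⟩ := exists_nat_pow_near_of_lt_one hu.1 hu.2.le (by norm_num : (0:ℝ) < 2⁻¹)
      (by norm_num)
    exact mem_iUnion.2 ⟨n, h1.le, h2⟩
  refine (lintegral_mono_set hcov).trans ((lintegral_iUnion_le _ _).trans ?_)
  set G : ℕ → ℝ≥0∞ := fun n => 2 ^ r * (maximalRearrangement f μ (2⁻¹ ^ n) / (n + 1)) ^ r with hG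
  rw [← ENNReal.tsum_mul_left]
  refine le_trans ?_ (ENNReal.tsum_comp_le_tsum_of_injective (add_left_injective 1) G)
  refine ENNReal.tsum_le_tsum fun j => ?_
  have hj : (0 : ℝ) < 2⁻¹ ^ (j + 1) := by positivity
  calc _ ≤ ∫⁻ _ in Icc ((2⁻¹ : ℝ) ^ (j + 1)) (2⁻¹ ^ j), G (j + 1) /
          ENNReal.ofReal (2⁻¹ ^ (j + 1)) := by
        refine setLIntegral_mono' measurableSet_Icc fun t ht => ?_
        have ht0 : 0 < t := hj.trans_le ht.1
        rw [hG]
        simp only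
        rw [← ENNReal.mul_rpow_of_nonneg _ _ hr.le]
        have hlog : ((j : ℝ) + 2) / 2 ≤ 1 + Real.log (1 / t) := by
          have h1 : (2 : ℝ) ^ j ≤ 1 / t := by
            rw [le_div_iff₀ ht0]
            calc (2 : ℝ) ^ j * t ≤ 2 ^ j * 2⁻¹ ^ j := by gcongr; exact ht.2
              _ = 1 := by rw [← mul_pow]; norm_num
          have h2 := Real.log_le_log (by positivity) h1
          rw [Real.log_pow] at h2
          have h3 := Real.log_two_gt_d9
          have h4 : (j : ℝ) * (1 / 2) ≤ j * Real.log 2 := by gcongr; linarith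
          linarith
        have h5 : maximalRearrangement f μ t / ENNReal.ofReal (1 + Real.log (1 / t)) ≤
            2 * (maximalRearrangement f μ (2⁻¹ ^ (j + 1)) / ((j + 1 : ℕ) + 1)) := by
          calc _ ≤ maximalRearrangement f μ (2⁻¹ ^ (j + 1)) /
                  ENNReal.ofReal (((j : ℝ) + 2) / 2) := by
                gcongr
                exact maximalRearrangement_antitoneOn (mem_Ioi.2 hj) ht0 ht.1
            _ = _ := by
                rw [ENNReal.ofReal_div_of_pos two_pos, ENNReal.div_eq_inv_mul,
                  ENNReal.inv_div (Or.inl (by simp)) (Or.inl (by simp)),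
                  ENNReal.ofReal_add (by positivity) (by norm_num), ENNReal.ofReal_natCast,
                  ENNReal.ofReal_ofNat, ENNReal.div_eq_inv_mul, ENNReal.div_eq_inv_mul,
                  mul_comm _ (2 : ℝ≥0∞), mul_assoc]
                congr 3
                push_cast
                rw [add_assoc, one_add_one_eq_two]
        gcongr
        exact ht.1
    _ ≤ G (j + 1) := by
        rw [setLIntegral_const, Real.volume_Icc,
          show (2⁻¹ : ℝ) ^ j - 2⁻¹ ^ (j + 1) = 2⁻¹ ^ (j + 1) by rw [pow_succ]; ring]
        rw [mul_comm]
        exact ENNReal.mul_div_le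

/-- The critical case: `f**` is evaluated along powers of `1 / 2` and Hardy's inequality is applied
to its increments. -/
theorem exists_logNorm_le (hs : 0 < s) (hα : 0 < α) (hb : 0 < b) (hc : 1 ≤ c) (hp : 1 ≤ p)
    (hσ1 : s / α < 1) (hsp : (1 / p).toReal = s / α) :
    ∃ C : ℝ≥0, ∀ (Ω : Type*) [MetricSpace Ω] [MeasurableSpace Ω] (μ : Measure Ω),
      IsAlmostContinuous c μ → IsLowerBounded α b μ → ∀ f : Ω → ℝ, MemLp f p μ →
      ∀ g ∈ gradients s f μ, logNorm p.toReal f μ ≤ C * (eLpNorm g p μ + sumNorm f μ) := by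
  have hσ : 0 < s / α := by positivity
  have hp' : p ≠ ∞ := ne_top_of_lt_toReal_one_div hσ hsp.ge
  have hp0 : p ≠ 0 := (zero_lt_one.trans_le hp).ne'
  have hr0 : 0 < p.toReal := ENNReal.toReal_pos hp0 hp'
  rw [ENNReal.toReal_div, ENNReal.toReal_one] at hsp
  set r := p.toReal with hrdef
  have hr1 : 1 < r := by rw [← hsp, div_lt_one hr0] at hσ1; exact hσ1
  obtain ⟨C₁, hC₁⟩ := exists_tsum_rpow_div_le hr1
  obtain ⟨C₂, hC₂⟩ := exists_powerNorm_maximalRearrangement_le (a := 1 / r) (hsp ▸ hσ1) hr1.le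
  set D := 4 * (3 * c / b) ^ (s / α) with hD
  have hD0 : 0 ≤ D := by positivity
  set M : ℝ≥0 := 2 ^ r * (C₁ * (1 + D.toNNReal ^ r * (2 * C₂ ^ r))) with hM
  refine ⟨M ^ (1 / r), fun Ω _ _ μ hac hlb f hf g hg => ?_⟩
  set W := eLpNorm g p μ + sumNorm f μ with hW
  have hF0 : maximalRearrangement f μ (2⁻¹ ^ 0) ^ r ≤ W ^ r := by
    rw [pow_zero]
    gcongr
    exact (maximalRearrangement_one_le_sumNorm hf.1).trans le_add_self
  have hgr : powerNorm (1 / r) r (maximalRearrangement g μ) ≤ C₂ * W := by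
    refine (hC₂ Ω μ g).trans ?_
    gcongr
    exact (powerNorm_one_div_rearrangement_le hg.1 hp0 hp').trans le_self_add
  have hsum : ∑' n : ℕ, (ENNReal.ofReal (D * (2⁻¹ ^ n) ^ (s / α)) *
      maximalRearrangement g μ (2⁻¹ ^ n)) ^ r ≤ ENNReal.ofReal D ^ r * (2 * C₂ ^ r * W ^ r) := by
    have hterm : ∀ n : ℕ, (ENNReal.ofReal (D * (2⁻¹ ^ n) ^ (s / α)) *
        maximalRearrangement g μ (2⁻¹ ^ n)) ^ r = ENNReal.ofReal D ^ r *
          (ENNReal.ofReal (2⁻¹ ^ n) * maximalRearrangement g μ (2⁻¹ ^ n) ^ r) := by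
      intro n
      rw [ENNReal.ofReal_mul hD0, ENNReal.mul_rpow_of_nonneg _ _ hr0.le,
        ENNReal.mul_rpow_of_nonneg _ _ hr0.le, mul_assoc,
        ENNReal.ofReal_rpow_of_pos (x := (2⁻¹ ^ n) ^ (s / α)) (by positivity),
        ← Real.rpow_mul (by positivity), ← hsp, one_div_mul_cancel hr0.ne', Real.rpow_one]
    simp only [hterm]
    rw [ENNReal.tsum_mul_left]
    gcongr
    refine (tsum_ofReal_mul_rpow_maximalRearrangement_le hr0).trans ?_
    rw [mul_assoc, ← ENNReal.mul_rpow_of_nonneg _ _ hr0.le]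
    gcongr
  have hH := hC₁ (fun n => maximalRearrangement f μ (2⁻¹ ^ n))
    (fun n => ENNReal.ofReal (D * (2⁻¹ ^ n) ^ (s / α)) * maximalRearrangement g μ (2⁻¹ ^ n))
    (fun n => by
      have := maximalRearrangement_half_le hs hα hb hc hac hlb hf.1 hg (t := 2⁻¹ ^ n)
        (by positivity)
      rwa [← pow_succ'] at this)
  have htotal : ∫⁻ t in Ioo (0 : ℝ) 1,
      (maximalRearrangement f μ t / ENNReal.ofReal (1 + Real.log (1 / t))) ^ r /
        ENNReal.ofReal t ≤ M * W ^ r := by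
    calc _ ≤ 2 ^ r * ∑' n : ℕ, (maximalRearrangement f μ (2⁻¹ ^ n) / (n + 1)) ^ r :=
          lintegral_rpow_div_log_le_tsum hr0
      _ ≤ 2 ^ r * (C₁ * (W ^ r + ENNReal.ofReal D ^ r * (2 * C₂ ^ r * W ^ r))) := by
          gcongr
          exact hH.trans (by gcongr)
      _ = M * W ^ r := by
          rw [hM]
          push_cast
          rw [ENNReal.coe_rpow_of_nonneg _ hr0.le, ENNReal.coe_rpow_of_nonneg _ hr0.le,
            ENNReal.coe_rpow_of_nonneg _ hr0.le, ENNReal.ofReal]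
          push_cast
          ring
  rw [logNorm]
  calc _ ≤ (M * W ^ r) ^ (1 / r) := by gcongr
    _ = _ := by
      rw [ENNReal.mul_rpow_of_nonneg _ _ (by positivity), ← ENNReal.rpow_mul,
        mul_one_div_cancel hr0.ne', ENNReal.rpow_one, ENNReal.coe_rpow_of_nonneg _ (by positivity)]

/-- For `p = 1` the weight in the oscillation bound cancels the division by `t`; taking the infimum
over all gradients gives the norm of `M^{s,1}`. -/
theorem weakLinftyNorm_le {C : ℝ≥0} (hC : 0 < C) {Ω : Type*} [MetricSpace Ω]
    [MeasurableSpace Ω] {μ : Measure Ω} {f : Ω → ℝ}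
    (h : ∀ g ∈ gradients s f μ, (⨆ (t : ℝ) (_ : 0 < t),
      ENNReal.ofReal (t ^ ((1 : ℝ≥0∞) / 1).toReal) *
        (oscillation f μ t / ENNReal.ofReal t)) ≤ C * eLpNorm g 1 μ) :
    weakLinftyNorm f μ ≤ C * hajlaszSobolevNorm s 1 f μ := by
  have hC0 : (C : ℝ≥0∞) ≠ 0 := by simpa using hC.ne'
  rw [← ENNReal.div_le_iff' hC0 ENNReal.coe_ne_top]
  refine le_trans (le_iInf fun g => le_iInf fun hg => ?_) (le_add_self)
  rw [ENNReal.div_le_iff' hC0 ENNReal.coe_ne_top]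
  refine le_trans (iSup_mono fun t => iSup_mono fun ht => ?_) (h g hg)
  have ht' : ENNReal.ofReal t ≠ 0 := by simpa using ht
  simp [ENNReal.mul_div_cancel ht' ENNReal.ofReal_ne_top]

end Embedding

end HajlaszSobolev

theorem mainTheorem4 (p : ℝ≥0∞) (hp : 1 ≤ p) (s α b c : ℝ) (hs : 0 < s) (hα : 0 < α)
    (hb : 0 < b) (hc : 1 ≤ c) :
    ∃ C : ℝ≥0, 0 < C ∧
      ∀ (Ω : Type*) [MetricSpace Ω] [MeasurableSpace Ω] [BorelSpace Ω] (μ : Measure Ω),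
        HajlaszSobolev.IsMetricMeasure μ →
        HajlaszSobolev.IsAlmostContinuous c μ →
        HajlaszSobolev.IsLowerBounded α b μ →
        ∀ f : Ω → ℝ, HajlaszSobolev.MemHajlaszSobolev s p f μ →
          (∀ g ∈ HajlaszSobolev.gradients s f μ,
            (s / α < 1 →
              (s / α < (1 / p).toReal →
                HajlaszSobolev.lorentzNorm (α * p.toReal / (α - s * p.toReal)) p.toReal f μ
                  ≤ C * eLpNorm g p μ) ∧
              ((1 / p).toReal = s / α →
                HajlaszSobolev.logNorm p.toReal f μ
                  ≤ C * (eLpNorm g p μ + HajlaszSobolev.sumNorm f μ)) ∧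
              ((1 / p).toReal < s / α →
                eLpNorm f ∞ μ ≤ C * (eLpNorm g p μ + HajlaszSobolev.sumNorm f μ))) ∧
            (s / α = 1 →
              (⨆ (t : ℝ) (_ : 0 < t), ENNReal.ofReal (t ^ (1 / p).toReal) *
                  (HajlaszSobolev.oscillation f μ t / ENNReal.ofReal t))
                ≤ C * eLpNorm g p μ) ∧
            (1 < s / α →
              eLpNorm f ∞ μ ≤ C * (eLpNorm g p μ + HajlaszSobolev.sumNorm f μ))) ∧
          (s / α = 1 → p = 1 →
            HajlaszSobolev.weakLinftyNorm f μ
              ≤ C * HajlaszSobolev.hajlaszSobolevNorm s p f μ) := by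
  have hσ : 0 < s / α := by positivity
  -- The four cases are made unconditional, with constant zero where a case does not occur, so
  -- that one constant serves for all of them.
  obtain ⟨C₁, h₁⟩ : ∃ C : ℝ≥0, s / α < (1 / p).toReal →
      ∀ (Ω : Type _) [MetricSpace Ω] [MeasurableSpace Ω] (μ : Measure Ω),
        HajlaszSobolev.IsAlmostContinuous c μ → HajlaszSobolev.IsLowerBounded α b μ →
        ∀ f : Ω → ℝ, MemLp f p μ → ∀ g ∈ HajlaszSobolev.gradients s f μ,
          HajlaszSobolev.lorentzNorm (α * p.toReal / (α - s * p.toReal)) p.toReal f μ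
            ≤ C * eLpNorm g p μ := by
    by_cases h : s / α < (1 / p).toReal
    · obtain ⟨C, hC⟩ := HajlaszSobolev.exists_lorentzNorm_le hs hα hb hc hp h
      exact ⟨C, fun _ => hC⟩
    · exact ⟨0, fun h' => absurd h' h⟩
  obtain ⟨C₂, h₂⟩ : ∃ C : ℝ≥0, s / α < 1 → (1 / p).toReal = s / α →
      ∀ (Ω : Type _) [MetricSpace Ω] [MeasurableSpace Ω] (μ : Measure Ω),
        HajlaszSobolev.IsAlmostContinuous c μ → HajlaszSobolev.IsLowerBounded α b μ →
        ∀ f : Ω → ℝ, MemLp f p μ → ∀ g ∈ HajlaszSobolev.gradients s f μ,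
          HajlaszSobolev.logNorm p.toReal f μ
            ≤ C * (eLpNorm g p μ + HajlaszSobolev.sumNorm f μ) := by
    by_cases h : s / α < 1 ∧ (1 / p).toReal = s / α
    · obtain ⟨C, hC⟩ := HajlaszSobolev.exists_logNorm_le hs hα hb hc hp h.1 h.2
      exact ⟨C, fun _ _ => hC⟩
    · exact ⟨0, fun h' h'' => absurd ⟨h', h''⟩ h⟩
  obtain ⟨C₃, h₃⟩ : ∃ C : ℝ≥0, (1 / p).toReal < s / α →
      ∀ (Ω : Type _) [MetricSpace Ω] [MeasurableSpace Ω] (μ : Measure Ω),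
        HajlaszSobolev.IsAlmostContinuous c μ → HajlaszSobolev.IsLowerBounded α b μ →
        ∀ f : Ω → ℝ, MemLp f p μ → ∀ g ∈ HajlaszSobolev.gradients s f μ,
          eLpNorm f ∞ μ ≤ C * (eLpNorm g p μ + HajlaszSobolev.sumNorm f μ) := by
    by_cases h : (1 / p).toReal < s / α
    · obtain ⟨C, hC⟩ := HajlaszSobolev.exists_eLpNorm_top_le hs hα hb hc hp h
      exact ⟨C, fun _ => hC⟩
    · exact ⟨0, fun h' => absurd h' h⟩
  obtain ⟨C₄, h₄⟩ : ∃ C : ℝ≥0, s / α = 1 →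
      ∀ (Ω : Type _) [MetricSpace Ω] [MeasurableSpace Ω] (μ : Measure Ω),
        HajlaszSobolev.IsAlmostContinuous c μ → HajlaszSobolev.IsLowerBounded α b μ →
        ∀ f : Ω → ℝ, MemLp f p μ → ∀ g ∈ HajlaszSobolev.gradients s f μ,
          (⨆ (t : ℝ) (_ : 0 < t), ENNReal.ofReal (t ^ (1 / p).toReal) *
            (HajlaszSobolev.oscillation f μ t / ENNReal.ofReal t)) ≤ C * eLpNorm g p μ := by
    by_cases h : s / α = 1
    · obtain ⟨C, hC⟩ := HajlaszSobolev.exists_iSup_oscillation_le hs hα hb hc hp h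
      exact ⟨C, fun _ => hC⟩
    · exact ⟨0, fun h' => absurd h' h⟩
  have hle₁ : C₁ ≤ 1 + (C₁ + C₂ + C₃ + C₄) := by
    rw [show 1 + (C₁ + C₂ + C₃ + C₄) = C₁ + (1 + C₂ + C₃ + C₄) by ring]; exact le_self_add
  have hle₂ : C₂ ≤ 1 + (C₁ + C₂ + C₃ + C₄) := by
    rw [show 1 + (C₁ + C₂ + C₃ + C₄) = C₂ + (1 + C₁ + C₃ + C₄) by ring]; exact le_self_add
  have hle₃ : C₃ ≤ 1 + (C₁ + C₂ + C₃ + C₄) := by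
    rw [show 1 + (C₁ + C₂ + C₃ + C₄) = C₃ + (1 + C₁ + C₂ + C₄) by ring]; exact le_self_add
  have hle₄ : C₄ ≤ 1 + (C₁ + C₂ + C₃ + C₄) := by
    rw [show 1 + (C₁ + C₂ + C₃ + C₄) = C₄ + (1 + C₁ + C₂ + C₃) by ring]; exact le_self_add
  have hpos : 0 < 1 + (C₁ + C₂ + C₃ + C₄) := add_pos_of_pos_of_nonneg one_pos (zero_le)
  generalize 1 + (C₁ + C₂ + C₃ + C₄) = C at hle₁ hle₂ hle₃ hle₄ hpos
  refine ⟨C, hpos, fun Ω _ _ _ μ _ hac hlb f hf => ?_⟩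
  have hf' : MemLp f p μ := hf.1
  have hosc : s / α = 1 → ∀ g ∈ HajlaszSobolev.gradients s f μ,
      (⨆ (t : ℝ) (_ : 0 < t), ENNReal.ofReal (t ^ (1 / p).toReal) *
        (HajlaszSobolev.oscillation f μ t / ENNReal.ofReal t)) ≤ C * eLpNorm g p μ :=
    fun h g hg => (h₄ h Ω μ hac hlb f hf' g hg).trans (by gcongr)
  -- The bound on `f` serves both for `1 / p < s / α < 1` and for `s / α > 1`, as `1 / p ≤ 1`.
  have hbdd : (1 / p).toReal < s / α → ∀ g ∈ HajlaszSobolev.gradients s f μ,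
      eLpNorm f ∞ μ ≤ C * (eLpNorm g p μ + HajlaszSobolev.sumNorm f μ) :=
    fun h g hg => (h₃ h Ω μ hac hlb f hf' g hg).trans (by gcongr)
  refine ⟨fun g hg => ⟨fun h1 => ⟨fun h => ?_, fun h => ?_, fun h => hbdd h g hg⟩,
    fun h => hosc h g hg, fun h => hbdd (lt_of_le_of_lt ?_ h) g hg⟩, fun h hp1 => ?_⟩
  · exact (h₁ h Ω μ hac hlb f hf' g hg).trans (by gcongr)
  · exact (h₂ h1 h Ω μ hac hlb f hf' g hg).trans (by gcongr)
  · rw [← ENNReal.toReal_one]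
    exact ENNReal.toReal_mono ENNReal.one_ne_top (ENNReal.div_le_of_le_mul (by simpa using hp))
  · subst hp1
    exact HajlaszSobolev.weakLinftyNorm_le hpos (hosc h)
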